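/- Let $b_j\ge 0$ ($j\neq 1$), $0<-b_1=\sum_{j\ne 1}b_j<\infty$ and $w_i>0$ ($i\ge1$). Let $\{X(t);t\ge 0\}$ be a regular weighted Markov branching process with $X(0)=1$ almost surely, i.e. a continuous-time Markov chain on $\mathbb Z_+$ whose almost all paths are right-continuous step functions with finitely many jumps in bounded time intervals, and whose honest standard transition function $(p_{ij}(t))$ has $Q$-matrix $q_{ij}=w_ib_{j-i+1}$ ($i\ge 1$, $j\ge i-1$), $q_{ij}=0$ otherwise, and satisfies $p_{ij}'(t)=\sum_{k}p_{ik}(t)q_{kj}$ for $i\ge0$, $j\ge1$, $t\ge 0$. Let $\tau=\inf\{t\ge 0: X(t)=0\}$. Let $m\in\mathbb Z_+$, $m\ne 1$, $b_m>0$, and let $Y_m(\tau)$ be the $(m-1)$-range crossing number until extinction, i.e. the number of times $t\in(0,\tau]$, $t<\infty$, with $X(t)-X(t-)=m-1$. Let $\rho$ be the minimal nonnegative root of $B(u)=\sum_{j\ge 0} b_ju^j=0$. Write $f^{*(j)}_l=\sum_{l_1+\cdots+l_j=l}f_{l_1}\cdots f_{l_j}$ for convolution powers (with $f^{*(0)}_0=1$,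 $f^{*(0)}_l=0$ for $l\geq 1$), and define $\rho_k$, $k\ge 0$, as follows. If $m=0$: $\rho_0=0$, $\rho_1=-b_0/b_1$, and for $k\ge 1$ $$\rho_{k+1}=-b_1^{-1}\sum_{j=2}^{k+1}b_j\,\rho^{*(j)}_{k+1}.$$ If $m>1$: $\rho_0$ is the minimal nonnegative root of $B_m(u)=\sum_{j\ne m}b_ju^j=0$, $\rho_1=-b_m\rho_0^m/B_m'(\rho_0)$, and for $k\ge 1$ $$\rho_{k+1}=-\frac{\sum_{i\ne 1,m}b_i\sum_{j_1+\cdots+j_i=k+1;\ j_1,\dots,j_i\le k}\rho_{j_1}\cdots\rho_{j_i}+b_m\rho^{*(m)}_k}{B_m'(\rho_0)}.$$ Then $\rho=1$ if and only if $B'(1)=\sum_j jb_j\le 0$. If $\rho=1$, then $\rho_k\ge 0$ for all $k$, $\tau<\infty$ and $Y_m(\tau)<\infty$ almost surely, $Y_m(\tau)$ is measurable up to a null set, $$E[Y_m(\tau)]=\sum_{k=0}^\infty k\rho_k\quad\text{in }[0,\infty],$$ and, whenever $\sum_{k} k\rho_k<\infty$, $$\mathrm{Var}[Y_m(\tau)]=\sum_{k=0}^\infty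 k^2\rho_k-\Big(\sum_{k=0}^\infty k\rho_k\Big)^2\quad\text{in }[0,\infty].$$ -/

import Mathlib

open MeasureTheory ProbabilityTheory Filter Topology
open scoped NNReal ENNReal

namespace WMB

/-! ### The branching `Q`-matrix -/

/-- The data `(b, w)` of a weighted branching `Q`-matrix: `b j ≥ 0` for `j ≠ 1`,
`0 < -b 1 = ∑_{j ≠ 1} b j < ∞` and `w i > 0` for `i ≥ 1` (the value `w 0` plays no role). -/
structure IsData (b w : ℕ → ℝ) : Prop where
  nonneg : ∀ j, j ≠ 1 → 0 ≤ b j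
  neg : b 1 < 0
  hasSum : HasSum (fun j => if j = 1 then 0 else b j) (-b 1)
  weight_pos : ∀ i, 1 ≤ i → 0 < w i

/-- `q i j = w i * b (j - i + 1)` if `i ≥ 1` and `j ≥ i - 1`, and `0` otherwise. -/
def qMatrix (b w : ℕ → ℝ) (i j : ℕ) : ℝ :=
  if 1 ≤ i ∧ i ≤ j + 1 then w i * b (j + 1 - i) else 0

/-! ### The process -/

/-- An honest standard transition function on `ℕ`; only the values at times `t ≥ 0` matter. -/
structure IsTransitionFunction (P : ℝ → ℕ → ℕ → ℝ) : Prop where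
  nonneg : ∀ t, 0 ≤ t → ∀ i j, 0 ≤ P t i j
  hasSum_one : ∀ t, 0 ≤ t → ∀ i, HasSum (fun j => P t i j) 1
  zero : ∀ i j, P 0 i j = if i = j then 1 else 0
  chapman_kolmogorov : ∀ s t, 0 ≤ s → 0 ≤ t → ∀ i j,
    HasSum (fun k => P s i k * P t k j) (P (s + t) i j)
  standard : ∀ i, Tendsto (fun t => P t i i) (𝓝[>] 0) (𝓝 1)

/-- `P` is the transition function of a weighted Markov branching process: its `Q`-matrix
(derivative at time `0`) is `qMatrix b w`, and it satisfies the forward equations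
`p'_{ij}(t) = ∑ₖ p_{ik}(t) q_{kj}` for `i ≥ 0`, `j ≥ 1`, `t ≥ 0`
(the terms with `k > j + 1` vanish, so the sum is finite). -/
structure IsBranchingTransitionFunction (b w : ℕ → ℝ) (P : ℝ → ℕ → ℕ → ℝ) : Prop
    extends IsTransitionFunction P where
  deriv_zero : ∀ i j,
    HasDerivWithinAt (fun s => P s i j) (qMatrix b w i j) (Set.Ici 0) 0
  forward : ∀ t, 0 ≤ t → ∀ i j, 1 ≤ j →
    HasDerivWithinAt (fun s => P s i j) (∑' k, P t i k * qMatrix b w k j) (Set.Ici 0) t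

/-- `X` is a continuous-time Markov chain on `ℕ` with transition function `P`: for all times
`t 0 ≤ t 1 ≤ ⋯ ≤ t (n + 1)` and states `i 0, …, i (n + 1)`,
`μ (X (t k) = i k for k ≤ n + 1) = μ (X (t k) = i k for k ≤ n) * P_{t (n+1) - t n}(i n, i (n+1))`. -/
structure IsMarkovChain {Ω : Type*} [MeasurableSpace Ω] (μ : Measure Ω)
    (P : ℝ → ℕ → ℕ → ℝ) (X : ℝ≥0 → Ω → ℕ) : Prop where
  measurable : ∀ t, Measurable (X t)
  markov : ∀ (n : ℕ) (t : ℕ → ℝ≥0) (i : ℕ → ℕ), Monotone t →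
    μ.real {ω | ∀ k ≤ n + 1, X (t k) ω = i k} =
      μ.real {ω | ∀ k ≤ n, X (t k) ω = i k} *
        P ((t (n + 1) : ℝ) - (t n : ℝ)) (i n) (i (n + 1))

/-- A regular (non-explosive) path: right-continuous with left limits in the discrete space `ℕ`,
that is, a right-continuous step function with finitely many jumps in each bounded interval. -/
def IsRegularPath (x : ℝ≥0 → ℕ) : Prop :=
  (∀ t, ∀ᶠ s in 𝓝[>] t, x s = x t) ∧
    ∀ t, 0 < t → ∃ i, ∀ᶠ s in 𝓝[<] t, x s = i

/-- `X` is a (regular) weighted Markov branching process with `Q`-matrix `qMatrix b w`. -/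
def IsProcess {Ω : Type*} [MeasurableSpace Ω] (μ : Measure Ω) (b w : ℕ → ℝ)
    (X : ℝ≥0 → Ω → ℕ) : Prop :=
  (∃ P, IsBranchingTransitionFunction b w P ∧ IsMarkovChain μ P X) ∧
    ∀ᵐ ω ∂μ, IsRegularPath (fun t => X t ω)

/-! ### Extinction time and crossing numbers -/

/-- The extinction time `τ = inf {t ≥ 0 : x t = 0}` of a path (`∞` if there is no such `t`). -/
noncomputable def extinctionTime (x : ℝ≥0 → ℕ) : ℝ≥0∞ :=
  ⨅ (t : ℝ≥0) (_ : x t = 0), (t : ℝ≥0∞)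

/-- An `(m - 1)`-range crossing at time `t > 0`: a jump `x t - x (t-) = m - 1`. -/
def IsCrossing (m : ℕ) (x : ℝ≥0 → ℕ) (t : ℝ≥0) : Prop :=
  0 < t ∧ ∃ i, (∀ᶠ s in 𝓝[<] t, x s = i) ∧ x t + 1 = i + m

/-- The number `Y_m(T)` of `(m - 1)`-range crossings up to time `T`. -/
noncomputable def crossingNumber (m : ℕ) (x : ℝ≥0 → ℕ) (T : ℝ≥0∞) : ℕ∞ :=
  Set.encard {t : ℝ≥0 | (t : ℝ≥0∞) ≤ T ∧ IsCrossing m x t}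

/-- The number `Y_m(τ)` of `(m - 1)`-range crossings until extinction. -/
noncomputable def crossingsUntilExtinction (m : ℕ) (x : ℝ≥0 → ℕ) : ℕ∞ :=
  crossingNumber m x (extinctionTime x)

/-! ### Generating functions and the coefficients `ρ_k` -/

/-- `B(u) = ∑ⱼ bⱼ uʲ`. -/
noncomputable def genFun (b : ℕ → ℝ) (u : ℝ) : ℝ := ∑' j, b j * u ^ j

/-- `B_m(u) = ∑_{j ≠ m} bⱼ uʲ`. -/
noncomputable def genFunOmit (b : ℕ → ℝ) (m : ℕ) (u : ℝ) : ℝ :=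
  ∑' j, if j = m then 0 else b j * u ^ j

/-- The minimal nonnegative root of `f`. -/
noncomputable def minRoot (f : ℝ → ℝ) : ℝ := sInf {u : ℝ | 0 ≤ u ∧ f u = 0}

/-- `B'(1) ≤ 0`, where `B'(1) = ∑ⱼ j bⱼ ∈ (-∞, ∞]`. -/
def DerivOneNonpos (b : ℕ → ℝ) : Prop :=
  Summable (fun j : ℕ => (j : ℝ) * b j) ∧ ∑' j : ℕ, (j : ℝ) * b j ≤ 0

/-- The convolution power `f^{*(j)}_l = ∑_{l₁ + ⋯ + lⱼ = l} f_{l₁} ⋯ f_{lⱼ}`. -/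
def convPow (f : ℕ → ℝ) (j l : ℕ) : ℝ :=
  ∑ x ∈ Finset.Nat.antidiagonalTuple j l, ∏ i, f (x i)

/-- The coefficients `ρ_k` for `m = 0`: `ρ_0 = 0`, `ρ_1 = -b_0 / b_1` and
`ρ_{k+1} = -(1 / b_1) ∑_{j=2}^{k+1} b_j ρ^{*(j)}_{k+1}` for `k ≥ 1`. As `ρ_0 = 0`, the convolution
powers involve only `ρ_0, …, ρ_k`, so `ρ` may be replaced there by its truncation after `k`. -/
noncomputable def deathCoeff (b : ℕ → ℝ) : ℕ → ℝ
  | 0 => 0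
  | 1 => -(b 0 / b 1)
  | k + 2 => -(∑ j ∈ Finset.Icc 2 (k + 2),
      b j * convPow (fun l => if _h : l ≤ k + 1 then deathCoeff b l else 0) j (k + 2)) / b 1
  termination_by k => k
  decreasing_by omega

/-- The coefficients `ρ_k` for `m > 1`: `ρ_0` is the minimal nonnegative root of `B_m`,
`ρ_1 = -b_m ρ_0^m / B_m'(ρ_0)`, and `ρ_{k+1}`, for `k ≥ 1`, is
`-(∑_{i ≠ 1, m} b_i ∑_{j₁ + ⋯ + jᵢ = k + 1, j₁, …, jᵢ ≤ k} ρ_{j₁} ⋯ ρ_{jᵢ} + b_m ρ^{*(m)}_k) / B_m'(ρ_0)`.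
The restriction `j₁, …, jᵢ ≤ k` is expressed by truncating `ρ` after `k`. -/
noncomputable def upCoeff (b : ℕ → ℝ) (m : ℕ) : ℕ → ℝ
  | 0 => minRoot (genFunOmit b m)
  | 1 => -(b m * upCoeff b m 0 ^ m / deriv (genFunOmit b m) (upCoeff b m 0))
  | k + 2 =>
      -((∑' i : ℕ, if i = 1 ∨ i = m then 0 else
            b i * convPow (fun l => if _h : l ≤ k + 1 then upCoeff b m l else 0) i (k + 2)) +
          b m * convPow (fun l => if _h : l ≤ k + 1 then upCoeff b m l else 0) m (k + 1)) /
        deriv (genFunOmit b m) (upCoeff b m 0)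
  termination_by k => k
  decreasing_by all_goals omega

/-- The coefficients `ρ_k` belonging to `m ≠ 1`. -/
noncomputable def coeff (b : ℕ → ℝ) (m : ℕ) : ℕ → ℝ :=
  if m = 0 then deathCoeff b else upCoeff b m

end WMB

/-! Crossings are steps of the embedded jump chain `Z`, stopped at `0`: since `m ≠ 1`, neither a
flat piece of the path nor the absorbed state contributes. From `i ≥ 1` this chain moves to `i + l -
1` with probability `b l / (-b 1)` for `l ≠ 1`; the weights `w` affect only the holding times and
cancel. The law of `Z` is obtained by discretisation: the process sampled on a grid of mesh `h` is a
discrete-time chain whose jump chain has transition probabilities `P h i j / (1 - P h i i)`, and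
these tend to the kernel above as `h → 0` (`measure_jumpChain_skeleton`,
`eventually_jumpChain_sample`, `exists_jumpChain_law`).

Let `s ∈ [0, 1]` and let `v ∈ [0, 1]` solve `∑_{j ≠ m} b_j v^j + s b_m v^m = 0`. Then `s ^ (number
of marked steps up to n) * v ^ Z n` has constant expectation `v`. If the minimal root of `B` is `1`,
then `B > 0` on `[0, 1)` and a similar weighting shows that `Z` reaches `0` almost surely. Dominated
convergence then gives `E[s ^ Y] = v` (`lintegral_pow_stepCount`), so the generating function `A(s)
= ∑ a_k s^k` of the crossing number satisfies the same equation with `A(s)` in place of `v`.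
Existence of some root `v` suffices; no uniqueness is needed.

Comparing coefficients of `s^l` (`coeff_equation`) determines `a_0` and then every `a_k`
recursively, because `a_n` enters the `n`-th equation linearly with a nonzero factor: `b_1` if `m =
0`, and `B_m'(a_0) < 0` if `m > 1`. Hence `a_k = ρ_k` (`eq_coeff`): the `ρ_k` are the distribution
of the crossing number, and nonnegativity and both moment formulas follow. The criterion `B'(1) ≤ 0`
is an elementary convexity statement about `B`. -/

namespace WMB

/-! ### Jump chains of paths and of their samples along grids -/

section JumpChain

variable {T : Type*} [InfSet T] [Zero T] [Add T]

/-- The path seen from its first jump on. Paths that start at `0` or never jump are unchanged. -/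
noncomputable def afterJump (x : T → ℕ) : T → ℕ :=
  if x 0 = 0 then x else fun t => x (sInf {s | x s ≠ x 0} + t)

/-- The successive values of a path, stopped at `0`. -/
noncomputable def jumpChain : ℕ → (T → ℕ) → ℕ
  | 0, x => x 0
  | n + 1, x => jumpChain n (afterJump x)

lemma jumpChain_succ (n : ℕ) (x : T → ℕ) : jumpChain (n + 1) x = jumpChain n (afterJump x) := rfl

lemma afterJump_of_zero {x : T → ℕ} (h : x 0 = 0) : afterJump x = x := if_pos h

lemma jumpChain_of_zero {x : T → ℕ} (h : x 0 = 0) (n : ℕ) : jumpChain n x = 0 := by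
  induction n with
  | zero => exact h
  | succ n ih => rw [jumpChain_succ, afterJump_of_zero h, ih]

end JumpChain

lemma jumpChain_eq_zero_succ {T : Type*} [InfSet T] [Zero T] [Add T] (n : ℕ) (x : T → ℕ)
    (h : jumpChain n x = 0) : jumpChain (n + 1) x = 0 := by
  induction n generalizing x with
  | zero => exact jumpChain_of_zero h 1
  | succ n ih => exact ih _ h

lemma afterJump_of_const {x : ℝ≥0 → ℕ} (h : ¬ ∃ s, x s ≠ x 0) : afterJump x = x := by
  have : {s | x s ≠ x 0} = ∅ := by
    ext s; simp only [Set.mem_ofPred_eq, Set.mem_empty_iff_false, iff_false]; exact fun hs => h ⟨s, hs⟩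
  unfold afterJump
  rw [this]
  simp

lemma afterJump_nat_of_const {y : ℕ → ℕ} (h : ∀ s, y s = y 0) : afterJump y = y := by
  have : {s | y s ≠ y 0} = ∅ := by
    ext s; simp [h s]
  unfold afterJump
  rw [this]
  simp

lemma afterJump_nat_eq {y : ℕ → ℕ} (h0 : y 0 ≠ 0) {k : ℕ} (hk : y k ≠ y 0)
    (hlt : ∀ l < k, y l = y 0) : afterJump y = fun l => y (k + l) := by
  have : sInf {s | y s ≠ y 0} = k := by
    apply le_antisymm (Nat.sInf_le hk)
    refine le_csInf ⟨k, hk⟩ fun l hl => ?_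
    by_contra hlk
    exact hl (hlt l (by omega))
  unfold afterJump
  rw [if_neg h0, this]

/-- Right-continuity of a path with values in the discrete space `ℕ`. -/
def IsRightContinuous (x : ℝ≥0 → ℕ) : Prop := ∀ t, ∀ᶠ s in 𝓝[>] t, x s = x t

lemma IsRightContinuous.exists_pos {x : ℝ≥0 → ℕ} (hx : IsRightContinuous x) (t : ℝ≥0) :
    ∃ ε > 0, ∀ δ < ε, x (t + δ) = x t := by
  have h := hx t
  rw [eventually_nhdsWithin_iff, Metric.eventually_nhds_iff] at h
  obtain ⟨ε, hε, h⟩ := h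
  refine ⟨⟨ε, hε.le⟩, hε, fun δ hδ => ?_⟩
  rcases eq_or_lt_of_le (zero_le : 0 ≤ δ) with h0 | h0
  · rw [← h0, add_zero]
  · apply h
    · rw [NNReal.dist_eq]
      push_cast
      rw [add_sub_cancel_left, abs_of_nonneg δ.coe_nonneg]
      exact_mod_cast hδ
    · simpa using h0

lemma IsRightContinuous.shift {x : ℝ≥0 → ℕ} (hx : IsRightContinuous x) (T : ℝ≥0) :
    IsRightContinuous fun t => x (T + t) := by
  intro t
  have h : Tendsto (fun s => T + s) (𝓝[>] t) (𝓝[>] (T + t)) := by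
    apply tendsto_nhdsWithin_of_tendsto_nhds_of_eventually_within
    · exact (tendsto_const_nhds.add tendsto_id).mono_left nhdsWithin_le_nhds
    · filter_upwards [self_mem_nhdsWithin] with s hs
      simpa using hs
  exact h.eventually (hx (T + t))

lemma IsRightContinuous.firstJump {x : ℝ≥0 → ℕ} (hx : IsRightContinuous x)
    (h : ∃ s, x s ≠ x 0) :
    0 < sInf {s | x s ≠ x 0} ∧ x (sInf {s | x s ≠ x 0}) ≠ x 0 ∧
      ∀ t < sInf {s | x s ≠ x 0}, x t = x 0 := by
  set T := sInf {s | x s ≠ x 0} with hT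
  have hlt : ∀ t < T, x t = x 0 := fun t ht => by
    by_contra hne
    exact absurd (csInf_le (OrderBot.bddBelow _) hne) (not_le.2 ht)
  have hne : x T ≠ x 0 := by
    intro heq
    obtain ⟨ε, hε, hε'⟩ := hx.exists_pos T
    have : T + ε ≤ T := by
      refine le_csInf h fun s hs => ?_
      by_contra hlt'
      have hTs : T ≤ s := csInf_le (OrderBot.bddBelow _) hs
      apply hs
      have := hε' (s - T) (by rw [tsub_lt_iff_left hTs]; exact not_le.1 hlt')
      rwa [add_tsub_cancel_of_le hTs, heq] at this
    exact absurd this (not_le.2 (lt_add_of_pos_right T hε))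
  refine ⟨?_, hne, hlt⟩
  rcases eq_or_lt_of_le (zero_le : 0 ≤ T) with h0 | h0
  · rw [← h0] at hne; exact absurd rfl hne
  · exact h0

/-- The jump chain of a right-continuous path is the limit of the jump chains of its samples along
finer and finer grids. -/
lemma eventually_jumpChain_sample (n : ℕ) {x : ℝ≥0 → ℕ} (hx : IsRightContinuous x)
    {a h : ℕ → ℝ≥0} (hh : ∀ N, 0 < h N) (ha0 : Tendsto a atTop (𝓝 0))
    (hh0 : Tendsto h atTop (𝓝 0)) :
    ∀ᶠ N in atTop, jumpChain n (fun k : ℕ => x (a N + k * h N)) = jumpChain n x := by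
  induction n generalizing x a with
  | zero =>
    obtain ⟨ε, hε, hε'⟩ := hx.exists_pos 0
    filter_upwards [ha0.eventually (gt_mem_nhds hε)] with N hN
    simpa [jumpChain] using hε' _ hN
  | succ n ih =>
    simp only [jumpChain_succ]
    by_cases h0 : x 0 = 0
    · obtain ⟨ε, hε, hε'⟩ := hx.exists_pos 0
      filter_upwards [ha0.eventually (gt_mem_nhds hε), ih hx ha0] with N hN hI
      have := hε' _ hN
      rw [zero_add] at this
      rw [afterJump_of_zero h0, afterJump_of_zero (by simpa [this] using h0), hI]
    by_cases hj : ∃ s, x s ≠ x 0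
    swap
    · filter_upwards [ih hx ha0] with N hI
      push Not at hj
      rw [afterJump_of_const (by simpa using hj), afterJump_nat_of_const, hI]
      intro s
      rw [hj, hj (a N + _)]
    obtain ⟨hT, hne, hlt⟩ := hx.firstJump hj
    have hshift : afterJump x = fun t => x (sInf {s | x s ≠ x 0} + t) := if_neg h0
    rw [hshift]
    generalize sInf {s | x s ≠ x 0} = T at hT hne hlt
    obtain ⟨ε, hε, hε'⟩ := hx.exists_pos T
    -- The first grid point at or after the jump time `T` overshoots it by less than one mesh width.
    -- That overshoot is the offset of the grid for the shifted path, which is why the induction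
    -- runs over arbitrary offsets tending to `0`.
    have hceil : ∀ N, a N < T → T ≤ a N + ⌈(T - a N) / h N⌉₊ * h N ∧
        a N + ⌈(T - a N) / h N⌉₊ * h N < T + h N := by
      intro N hN
      have h1 := Nat.le_ceil ((T - a N) / h N)
      have h2 := Nat.ceil_lt_add_one (zero_le : 0 ≤ (T - a N) / h N)
      rw [div_le_iff₀ (hh N)] at h1
      have h3 := mul_lt_mul_of_pos_right h2 (hh N)
      rw [add_mul, div_mul_cancel₀ _ (hh N).ne', one_mul] at h3
      constructor
      · exact tsub_le_iff_left.1 h1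
      · calc _ < a N + (T - a N + h N) := by gcongr
          _ = T + h N := by rw [← add_assoc, add_tsub_cancel_of_le hN.le]
    have ha' : Tendsto (fun N => a N + ⌈(T - a N) / h N⌉₊ * h N - T) atTop (𝓝 0) := by
      refine tendsto_of_tendsto_of_tendsto_of_le_of_le' tendsto_const_nhds hh0
        (Eventually.of_forall fun _ => zero_le) ?_
      filter_upwards [ha0.eventually (gt_mem_nhds hT)] with N hN
      exact tsub_le_iff_left.2 (hceil N hN).2.le
    -- The grid must be fine enough that it starts before `T` and that its first point after `T`
    -- still sees the value `x T`; then no jump is missed.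
    filter_upwards [ha0.eventually (gt_mem_nhds hT), hh0.eventually (gt_mem_nhds hε),
      ih (hx.shift T) ha'] with N hN hhN hI
    rw [← hI]
    obtain ⟨c1, c2⟩ := hceil N hN
    have hy0 : x (a N + (0 : ℕ) * h N) = x 0 := by simpa using hlt _ hN
    rw [afterJump_nat_eq (k := ⌈(T - a N) / h N⌉₊)]
    · congr 1
      ext k
      congr 1
      rw [← add_assoc, add_tsub_cancel_of_le c1]
      push_cast
      ring
    · rwa [hy0]
    · rw [hy0]
      have := hε' (a N + ⌈(T - a N) / h N⌉₊ * h N - T)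
        (lt_of_le_of_lt (tsub_le_iff_left.2 c2.le) hhN)
      rw [add_tsub_cancel_of_le c1] at this
      rwa [this]
    · intro l hl
      rw [hy0]
      apply hlt
      have := Nat.lt_ceil.1 hl
      rw [lt_div_iff₀ (hh N)] at this
      calc _ < a N + (T - a N) := by gcongr
        _ = T := add_tsub_cancel_of_le hN.le

/-! ### Extinction and crossings read off the jump chain -/

lemma extinctionTime_of_zero {x : ℝ≥0 → ℕ} (h : x 0 = 0) : extinctionTime x = 0 := by
  apply le_antisymm _ zero_le
  exact iInf₂_le_of_le 0 h (by simp)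

lemma extinctionTime_shift {x : ℝ≥0 → ℕ} {T : ℝ≥0} (hT : ∀ t < T, x t ≠ 0) :
    extinctionTime x = T + extinctionTime fun t => x (T + t) := by
  unfold extinctionTime
  apply le_antisymm
  · rw [ENNReal.add_iInf]
    refine le_iInf fun t => ?_
    by_cases ht : x (T + t) = 0
    · simp only [ht, iInf_pos]
      exact iInf₂_le_of_le (T + t) ht (by push_cast; rfl)
    · simp [ht]
  · refine le_iInf₂ fun t ht => ?_
    have hTt : T ≤ t := by
      by_contra hlt
      exact hT t (not_le.1 hlt) ht
    have : (t : ℝ≥0∞) = T + ((t - T : ℝ≥0) : ℝ≥0∞) := by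
      rw [← ENNReal.coe_add, add_tsub_cancel_of_le hTt]
    rw [this]
    gcongr
    exact iInf₂_le (t - T) (by simpa only [add_tsub_cancel_of_le hTt] using ht)

/-- Translation by `T` carries left neighbourhoods of `t` to those of `T + t`. This fails at `t =
0`, where the left neighbourhood in `ℝ≥0` is empty. -/
lemma isCrossing_shift (m : ℕ) (x : ℝ≥0 → ℕ) (T : ℝ≥0) {t : ℝ≥0} (ht : 0 < t) :
    IsCrossing m (fun s => x (T + s)) t ↔ IsCrossing m x (T + t) := by
  have hmap : map (fun s => T + s) (𝓝[<] t) = 𝓝[<] (T + t) := by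
    apply le_antisymm
    · apply tendsto_nhdsWithin_of_tendsto_nhds_of_eventually_within
      · exact (tendsto_const_nhds.add tendsto_id).mono_left nhdsWithin_le_nhds
      · filter_upwards [self_mem_nhdsWithin] with s hs
        simpa using hs
    · intro S hS
      rw [mem_map, mem_nhdsWithin_iff_exists_mem_nhds_inter] at hS
      obtain ⟨U, hU, hUS⟩ := hS
      have h1 : Tendsto (fun s => s - T) (𝓝[<] (T + t)) (𝓝 t) := by
        have : Tendsto (fun s : ℝ≥0 => s - T) (𝓝 (T + t)) (𝓝 (T + t - T)) :=
          (continuous_id.sub continuous_const).tendsto _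
        rw [add_tsub_cancel_left] at this
        exact this.mono_left nhdsWithin_le_nhds
      have h2 : ∀ᶠ s in 𝓝[<] (T + t), T < s :=
        nhdsWithin_le_nhds (lt_mem_nhds (by simpa using ht))
      filter_upwards [h1 hU, h2, self_mem_nhdsWithin] with s hs hTs hst
      have : s - T ∈ U ∩ Set.Iio t := ⟨hs, by
        rw [Set.mem_Iio, tsub_lt_iff_left hTs.le]; exact hst⟩
      have := hUS this
      rwa [Set.mem_preimage, add_tsub_cancel_of_le hTs.le] at this
  unfold IsCrossing
  rw [← hmap]
  simp [eventually_map, ht]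

lemma encard_setOf_nat_succ (p : ℕ → Prop) [Decidable (p 0)] :
    {k | p k}.encard = (if p 0 then 1 else 0) + {k | p (k + 1)}.encard := by
  have h1 : {k | p k} = {k | k = 0 ∧ p 0} ∪ Nat.succ '' {k | p (k + 1)} := by
    ext k
    cases k <;> simp
  rw [h1, Set.encard_union_eq, Nat.succ_injective.encard_image]
  · congr 1
    split_ifs with h <;> simp [h]
  · rw [Set.disjoint_left]
    rintro k ⟨rfl, -⟩ ⟨l, -, hl⟩
    simp at hl

/-- If the jump chain reaches `0`, the crossings until extinction are the steps of the chain. -/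
lemma crossingsUntilExtinction_eq {m : ℕ} (hm : m ≠ 1) (n : ℕ) {x : ℝ≥0 → ℕ}
    (hx : IsRightContinuous x) (h : jumpChain n x = 0) :
    extinctionTime x < ⊤ ∧ crossingsUntilExtinction m x =
      {k | jumpChain (k + 1) x + 1 = jumpChain k x + m}.encard := by
  classical
  induction n generalizing x with
  | zero =>
    have h0 : x 0 = 0 := h
    refine ⟨by simp [extinctionTime_of_zero h0], ?_⟩
    unfold crossingsUntilExtinction crossingNumber
    rw [extinctionTime_of_zero h0]
    simp only [jumpChain_of_zero h0]
    have h1 : {t : ℝ≥0 | (t : ℝ≥0∞) ≤ 0 ∧ IsCrossing m x t} = ∅ := by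
      ext t
      simp only [IsCrossing, Set.mem_ofPred_eq, nonpos_iff_eq_zero, ENNReal.coe_eq_zero,
        Set.mem_empty_iff_false, iff_false]
      rintro ⟨rfl, h, -⟩
      exact absurd h (lt_irrefl _)
    -- Here `m ≠ 1` keeps the idle steps of the absorbed chain from being counted.
    have h2 : {k : ℕ | 0 + 1 = 0 + m} = ∅ := by
      ext k
      simp only [Set.mem_ofPred_eq, Set.mem_empty_iff_false, iff_false]
      omega
    rw [h1, h2, Set.encard_empty, Set.encard_empty]
  | succ n ih =>
    rw [jumpChain_succ] at h
    by_cases h0 : x 0 = 0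
    · exact ih hx (jumpChain_of_zero h0 n)
    by_cases hj : ∃ s, x s ≠ x 0
    swap
    · rw [afterJump_of_const hj] at h
      exact ih hx h
    obtain ⟨hT, hne, hlt⟩ := hx.firstJump hj
    have hshift : afterJump x = fun t => x (sInf {s | x s ≠ x 0} + t) := if_neg h0
    generalize sInf {s | x s ≠ x 0} = T at hT hne hlt hshift
    rw [hshift] at h
    obtain ⟨ih1, ih2⟩ := ih (hx.shift T) h
    have hext := extinctionTime_shift (x := x) (T := T) fun t ht => by rw [hlt t ht]; exact h0
    refine ⟨by rw [hext]; exact ENNReal.add_lt_top.2 ⟨ENNReal.coe_lt_top, ih1⟩, ?_⟩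
    rw [encard_setOf_nat_succ]
    have hs : ∀ k, jumpChain (k + 1) x = jumpChain k fun t => x (T + t) := fun k => by
      rw [jumpChain_succ, hshift]
    simp only [hs]
    rw [← ih2]
    have hleft : ∀ᶠ s in 𝓝[<] T, x s = x 0 := by
      filter_upwards [self_mem_nhdsWithin] with s hs using hlt s hs
    have hcross : IsCrossing m x T ↔ x T + 1 = x 0 + m := by
      constructor
      · rintro ⟨-, i, hi, hi'⟩
        have : (𝓝[<] T).NeBot := nhdsLT_neBot_of_exists_lt ⟨0, hT⟩
        obtain ⟨s, hs1, hs2⟩ := (hi.and hleft).exists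
        rw [hi', ← hs1, hs2]
      · exact fun h => ⟨hT, _, hleft, h⟩
    -- Before the first jump `T` the path is constant, and a null jump is no crossing since `m ≠ 1`.
    -- So the crossings are the possible one at `T` and those of the shifted path.
    have hset : {t : ℝ≥0 | (t : ℝ≥0∞) ≤ extinctionTime x ∧ IsCrossing m x t} =
        {t | t = T ∧ x T + 1 = x 0 + m} ∪ (fun t => T + t) ''
          {t : ℝ≥0 | (t : ℝ≥0∞) ≤ extinctionTime (fun t => x (T + t)) ∧
            IsCrossing m (fun t => x (T + t)) t} := by
      ext t
      simp only [Set.mem_ofPred_eq, Set.mem_union, Set.mem_image]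
      constructor
      · rintro ⟨h1, h2⟩
        rcases lt_trichotomy t T with h3 | rfl | h3
        · exfalso
          obtain ⟨h4, i, hi, hi'⟩ := h2
          have : (𝓝[<] t).NeBot := nhdsLT_neBot_of_exists_lt ⟨0, h4⟩
          obtain ⟨s, hs1, hs2⟩ := (hi.and self_mem_nhdsWithin).exists
          rw [hlt s (lt_trans hs2 h3)] at hs1
          rw [hlt t h3] at hi'
          omega
        · exact Or.inl ⟨rfl, hcross.1 h2⟩
        · right
          refine ⟨t - T, ⟨?_, ?_⟩, add_tsub_cancel_of_le h3.le⟩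
          · rw [hext] at h1
            rw [ENNReal.coe_sub]
            exact tsub_le_iff_left.2 h1
          · rw [isCrossing_shift m x T (tsub_pos_of_lt h3), add_tsub_cancel_of_le h3.le]
            exact h2
      · rintro (⟨rfl, h1⟩ | ⟨t, ⟨h1, h2⟩, rfl⟩)
        · exact ⟨by rw [hext]; exact le_self_add, hcross.2 h1⟩
        · refine ⟨?_, (isCrossing_shift m x T h2.1).1 h2⟩
          rw [hext]
          push_cast
          gcongr
    unfold crossingsUntilExtinction crossingNumber
    rw [hset, Set.encard_union_eq, (add_right_injective T).encard_image]
    · congr 1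
      simp only [jumpChain, add_zero]
      split_ifs with h <;> simp [h]
    · rw [Set.disjoint_left]
      rintro t ⟨rfl, -⟩ ⟨s, ⟨-, hs⟩, hs'⟩
      have : s = 0 := by simpa using hs'
      exact hs.1.ne' this

/-! ### The jump chain of a discrete-time Markov chain -/

lemma measurableSet_forall_eq {Ω : Type*} [MeasurableSpace Ω] {f : ℕ → Ω → ℕ}
    (hf : ∀ k, Measurable (f k)) (n : ℕ) (i : ℕ → ℕ) :
    MeasurableSet {ω | ∀ k ≤ n, f k ω = i k} := by
  have : {ω | ∀ k ≤ n, f k ω = i k} = ⋂ k, ⋂ _ : k ≤ n, {ω | f k ω = i k} := by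
    ext ω; simp
  rw [this]
  exact MeasurableSet.iInter fun k => MeasurableSet.iInter fun _ =>
    measurableSet_eq_fun (hf k) measurable_const

lemma measurable_sInf_ne : Measurable fun y : ℕ → ℕ => sInf {s | y s ≠ y 0} := by
  have key : ∀ t : ℕ, MeasurableSet ((fun y : ℕ → ℕ => sInf {s | y s ≠ y 0}) ⁻¹' {t + 1}) := by
    intro t
    have : (fun y : ℕ → ℕ => sInf {s | y s ≠ y 0}) ⁻¹' {t + 1} =
        {y : ℕ → ℕ | y (t + 1) ≠ y 0} ∩ ⋂ l : Fin (t + 1), {y : ℕ → ℕ | y l = y 0} := by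
      ext y
      simp only [Set.mem_preimage, Set.mem_singleton_iff, Set.mem_inter_iff, Set.mem_ofPred_eq,
        Set.mem_iInter]
      constructor
      · intro h
        have hne : {s | y s ≠ y 0}.Nonempty := Nat.nonempty_of_sInf_eq_succ h
        refine ⟨?_, fun l => ?_⟩
        · rw [← h]; exact Nat.sInf_mem hne
        · by_contra hl
          have := Nat.sInf_le (s := {s | y s ≠ y 0}) hl
          have := l.2
          omega
      · rintro ⟨h1, h2⟩
        apply le_antisymm (Nat.sInf_le h1)
        refine le_csInf ⟨_, h1⟩ fun l hl => ?_
        by_contra hlk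
        exact hl (h2 ⟨l, by omega⟩)
    rw [this]
    have hev : ∀ l : ℕ, Measurable fun y : ℕ → ℕ => y l := fun l => measurable_pi_apply l
    exact (measurableSet_eq_fun (hev _) (hev _)).compl.inter
      (MeasurableSet.iInter fun l => measurableSet_eq_fun (hev _) (hev _))
  refine measurable_to_countable' fun t => ?_
  cases t with
  | succ t => exact key t
  | zero =>
    have : (fun y : ℕ → ℕ => sInf {s | y s ≠ y 0}) ⁻¹' {0} =
        (⋃ t : ℕ, (fun y : ℕ → ℕ => sInf {s | y s ≠ y 0}) ⁻¹' {t + 1})ᶜ := by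
      ext y
      simp only [Set.mem_preimage, Set.mem_singleton_iff, Set.mem_compl_iff, Set.mem_iUnion,
        not_exists]
      constructor
      · intro h t; omega
      · intro h
        by_contra h0
        exact h (sInf {s | y s ≠ y 0} - 1) (by omega)
    rw [this]
    exact (MeasurableSet.iUnion key).compl

lemma measurable_afterJump : Measurable (afterJump : (ℕ → ℕ) → ℕ → ℕ) := by
  refine measurable_pi_lambda _ fun l => ?_
  have heval : Measurable fun p : (ℕ → ℕ) × ℕ => p.1 p.2 :=
    measurable_from_prod_countable_left fun k => measurable_pi_apply k
  have h : Measurable fun y : ℕ → ℕ => y (sInf {s | y s ≠ y 0} + l) :=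
    heval.comp (measurable_id.prodMk (measurable_sInf_ne.add_const l))
  have : (fun y : ℕ → ℕ => afterJump y l) =
      fun y => if y 0 = 0 then y l else y (sInf {s | y s ≠ y 0} + l) := by
    ext y
    unfold afterJump
    split_ifs <;> rfl
  rw [this]
  exact Measurable.ite (measurableSet_eq_fun (measurable_pi_apply 0) measurable_const)
    (measurable_pi_apply l) h

lemma measurable_jumpChain (n : ℕ) : Measurable (jumpChain n : (ℕ → ℕ) → ℕ) := by
  induction n with
  | zero => exact measurable_pi_apply 0
  | succ n ih => exact ih.comp measurable_afterJump

/-- The transition matrix of the jump chain of a Markov chain with transition matrix `p`, stopped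
at `0`. -/
noncomputable def skeletonKernel (p : ℕ → ℕ → ℝ≥0∞) (i j : ℕ) : ℝ≥0∞ :=
  if i = 0 then (if j = 0 then 1 else 0) else if j = i then 0 else p i j * (1 - p i i)⁻¹

section Skeleton

variable {Ω : Type*} [MeasurableSpace Ω] {μ : Measure Ω} {Y : Ω → ℕ → ℕ} {p : ℕ → ℕ → ℝ≥0∞}

/-- The path `w (min l k)` follows `w` up to time `k` and is then frozen; each frozen step costs a
factor `p (w k) (w k)`. -/
lemma measure_stay
    (hp : ∀ (n : ℕ) (i : ℕ → ℕ), μ {ω | ∀ k ≤ n + 1, Y ω k = i k} =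
      μ {ω | ∀ k ≤ n, Y ω k = i k} * p (i n) (i (n + 1))) (k : ℕ) (w : ℕ → ℕ) (c : ℕ) :
    μ {ω | ∀ l ≤ k + c, Y ω l = w (min l k)} =
      μ {ω | ∀ l ≤ k, Y ω l = w l} * p (w k) (w k) ^ c := by
  induction c with
  | zero =>
    rw [pow_zero, mul_one]
    congr 1
    ext ω
    simp only [Set.mem_ofPred_eq, add_zero]
    exact forall₂_congr fun l hl => by rw [min_eq_left hl]
  | succ c ih =>
    have := hp (k + c) fun l => w (min l k)
    rw [← add_assoc, this, ih, min_eq_right (by omega), min_eq_right (by omega), pow_succ, mul_assoc]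

/-- The law of the jump chain of a discrete-time Markov chain, given an initial segment. -/
lemma measure_jumpChain_skeleton [IsFiniteMeasure μ] (hY : ∀ k, Measurable fun ω => Y ω k)
    (hp : ∀ (n : ℕ) (i : ℕ → ℕ), μ {ω | ∀ k ≤ n + 1, Y ω k = i k} =
      μ {ω | ∀ k ≤ n, Y ω k = i k} * p (i n) (i (n + 1)))
    (n : ℕ) : ∀ (k : ℕ) (w i : ℕ → ℕ), i 0 = w k → (∀ r < n, i r ≠ 0 → p (i r) (i r) < 1) →
    μ {ω | (∀ l ≤ k, Y ω l = w l) ∧ ∀ r ≤ n, jumpChain r (fun l => Y ω (k + l)) = i r} =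
      μ {ω | ∀ l ≤ k, Y ω l = w l} *
        ∏ r ∈ Finset.range n, skeletonKernel p (i r) (i (r + 1)) := by
  induction n with
  | zero =>
    intro k w i h0 _
    rw [Finset.prod_range_zero, mul_one]
    congr 1
    ext ω
    simp only [Set.mem_ofPred_eq, nonpos_iff_eq_zero, forall_eq, jumpChain, add_zero]
    constructor
    · exact fun h => h.1
    · exact fun h => ⟨h, by rw [h k le_rfl, h0]⟩
  | succ n ih =>
    intro k w i h0 hi
    rw [Finset.prod_range_succ']
    have hsplit : ∀ ω, (∀ l ≤ k, Y ω l = w l) →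
        ((∀ r ≤ n + 1, jumpChain r (fun l => Y ω (k + l)) = i r) ↔
          ∀ r ≤ n, jumpChain r (afterJump fun l => Y ω (k + l)) = i (r + 1)) := by
      intro ω hω
      constructor
      · exact fun h r hr => h (r + 1) (by omega)
      · intro h r hr
        cases r with
        | zero => simp [jumpChain, hω, h0]
        | succ r => exact h r (by omega)
    by_cases hz : i 0 = 0
    · have haft : ∀ ω, (∀ l ≤ k, Y ω l = w l) →
          (afterJump fun l => Y ω (k + l)) = fun l => Y ω (k + l) := fun ω hω =>
        afterJump_of_zero (by rw [add_zero, hω k le_rfl, ← h0, hz])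
      by_cases hz1 : i 1 = 0
      · have := ih k w (fun r => i (r + 1)) (by simp [hz1, ← h0, hz])
          fun r hr => hi (r + 1) (by omega)
        have hK : skeletonKernel p (i 0) (i (0 + 1)) = 1 := by simp [skeletonKernel, hz, hz1]
        rw [hK, mul_one, ← this]
        congr 1
        ext ω
        simp only [Set.mem_ofPred_eq]
        refine and_congr_right fun hω => ?_
        rw [hsplit ω hω, haft ω hω]
      · have : {ω | (∀ l ≤ k, Y ω l = w l) ∧
            ∀ r ≤ n + 1, jumpChain r (fun l => Y ω (k + l)) = i r} = ∅ := by
          ext ω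
          simp only [Set.mem_ofPred_eq, Set.mem_empty_iff_false, iff_false]
          rintro ⟨hω, h⟩
          have := h 1 (by omega)
          rw [jumpChain_of_zero (by rw [add_zero, hω k le_rfl, ← h0, hz])] at this
          exact hz1 this.symm
        rw [this]
        simp [skeletonKernel, hz, hz1]
    have hw : w k ≠ 0 := h0 ▸ hz
    by_cases h1 : i 1 = i 0
    · have hK : skeletonKernel p (i 0) (i (0 + 1)) = 0 := by simp [skeletonKernel, hz, h1]
      rw [hK, mul_zero, mul_zero]
      -- From a nonzero state the jump chain repeats a value only if the path never moves again.
      -- That event lies in staying put for `c` steps, for every `c`, and `p (w k) (w k) < 1` makes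
      -- it null.
      have hlt := hi 0 (by omega) hz
      have hlim : Tendsto (fun c => μ {ω | ∀ l ≤ k, Y ω l = w l} * p (w k) (w k) ^ c) atTop
          (𝓝 (μ {ω | ∀ l ≤ k, Y ω l = w l} * 0)) :=
        ENNReal.Tendsto.const_mul (ENNReal.tendsto_pow_atTop_nhds_zero_of_lt_one (h0 ▸ hlt))
          (Or.inr (measure_ne_top _ _))
      rw [mul_zero] at hlim
      refine le_antisymm (ge_of_tendsto' hlim fun c => ?_) zero_le
      rw [← measure_stay hp]
      apply measure_mono
      rintro ω ⟨hω, h⟩ l -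
      have hconst : ∀ s, Y ω (k + s) = Y ω (k + 0) := by
        by_contra hne
        push Not at hne
        classical
        have hsp := Nat.find_spec hne
        have := h 1 (by omega)
        rw [jumpChain_succ, afterJump_nat_eq (y := fun l => Y ω (k + l)) (k := Nat.find hne) (by rwa [add_zero, hω k le_rfl])
          hsp fun l hl => not_not.1 (Nat.find_min hne hl)] at this
        apply hsp
        simp only [jumpChain] at this
        rw [← add_zero (Nat.find hne), this, h1, h0, add_zero, hω k le_rfl]
      rcases le_total l k with hl | hl
      · rw [min_eq_left hl, hω l hl]
      · have := hconst (l - k)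
        rw [Nat.add_sub_cancel' hl] at this
        rw [this, min_eq_right hl, add_zero, hω k le_rfl]
    -- decompose according to the time of the first jump after time `k`
    set w' : ℕ → ℕ → ℕ := fun c l => if l ≤ k + c then w (min l k) else i 1 with hw'
    set E : ℕ → Set Ω := fun c => {ω | (∀ l ≤ k + c + 1, Y ω l = w' c l) ∧
      ∀ r ≤ n, jumpChain r (fun l => Y ω (k + c + 1 + l)) = i (r + 1)} with hE
    have hpre : ∀ c ω, (∀ l ≤ k + c + 1, Y ω l = w' c l) ↔
        (∀ l ≤ k + c, Y ω l = w (min l k)) ∧ Y ω (k + c + 1) = i 1 := by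
      intro c ω
      constructor
      · intro h
        refine ⟨fun l hl => ?_, ?_⟩
        · rw [h l (by omega)]; exact if_pos hl
        · rw [h _ le_rfl]; exact if_neg (by omega)
      · rintro ⟨h1, h2⟩ l hl
        rcases hl.lt_or_eq with hl | rfl
        · rw [h1 l (by omega)]; exact (if_pos (by omega)).symm
        · rw [h2]; exact (if_neg (by omega)).symm
    have haft : ∀ c ω, (∀ l ≤ k + c, Y ω l = w (min l k)) → Y ω (k + (c + 1)) ≠ w k →
        (afterJump fun l => Y ω (k + l)) = fun l => Y ω (k + c + 1 + l) := by
      intro c ω h1 h2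
      have hk : Y ω (k + 0) = w k := by rw [h1 _ (by omega), min_eq_right (by omega)]
      rw [afterJump_nat_eq (k := c + 1)]
      · ext l; congr 1; ring
      · rwa [hk]
      · rwa [hk]
      · intro l hl
        rw [hk, h1 _ (by omega), min_eq_right (by omega)]
    have hunion : {ω | (∀ l ≤ k, Y ω l = w l) ∧
        ∀ r ≤ n + 1, jumpChain r (fun l => Y ω (k + l)) = i r} = ⋃ c, E c := by
      ext ω
      simp only [Set.mem_ofPred_eq, Set.mem_iUnion, hE]
      constructor
      · rintro ⟨hω, h⟩
        have hj : ∃ s, Y ω (k + s) ≠ w k := by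
          by_contra hcon
          push Not at hcon
          have := h 1 (by omega)
          rw [jumpChain_succ, afterJump_nat_of_const fun s => by rw [hcon, hcon]] at this
          simp only [jumpChain] at this
          rw [hcon, ← h0] at this
          exact h1 this.symm
        classical
        obtain ⟨c, hc⟩ : ∃ c, Nat.find hj = c + 1 := by
          apply Nat.exists_eq_succ_of_ne_zero
          intro h0'
          have := Nat.find_spec hj
          rw [h0', add_zero, hω k le_rfl] at this
          exact this rfl
        have hc1 : ∀ l ≤ k + c, Y ω l = w (min l k) := by
          intro l hl
          rcases le_total l k with hlk | hlk
          · rw [min_eq_left hlk, hω l hlk]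
          · have := not_not.1 (Nat.find_min hj (m := l - k) (by omega))
            rw [min_eq_right hlk, ← this, Nat.add_sub_cancel' hlk]
        have hc2 := Nat.find_spec hj
        rw [hc] at hc2
        have hA := haft c ω hc1 hc2
        have hB := (hsplit ω hω).1 h
        rw [hA] at hB
        exact ⟨c, (hpre c ω).2 ⟨hc1, hB 0 (by omega)⟩, hB⟩
      · rintro ⟨c, hc, h⟩
        obtain ⟨hc1, hc2⟩ := (hpre c ω).1 hc
        have hω : ∀ l ≤ k, Y ω l = w l := fun l hl => by
          rw [hc1 l (by omega), min_eq_left hl]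
        refine ⟨hω, (hsplit ω hω).2 ?_⟩
        rw [haft c ω hc1 (by rw [← add_assoc, hc2, ← h0]; exact h1)]
        exact h
    have hdisj : Pairwise (Function.onFun Disjoint E) := by
      have aux : ∀ c d, c < d → Disjoint (E c) (E d) := by
        intro c d hcd
        rw [Set.disjoint_left]
        rintro ω ⟨hc, -⟩ ⟨hd, -⟩
        have e1 := ((hpre c ω).1 hc).2
        have e2 := ((hpre d ω).1 hd).1 (k + c + 1) (by omega)
        rw [e1, min_eq_right (by omega), ← h0] at e2
        exact h1 e2
      intro c d hcd
      rcases lt_or_gt_of_ne hcd with h | h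
      · exact aux c d h
      · exact (aux d c h).symm
    have hmeas : ∀ c, MeasurableSet (E c) := by
      intro c
      exact (measurableSet_forall_eq hY _ _).inter (measurableSet_forall_eq (fun r =>
        (measurable_jumpChain r).comp (measurable_pi_lambda _ fun l => hY _)) _ _)
    -- On `E c` the path waits `c` steps, jumps to `i 1`, and then the induction hypothesis applies.
    -- The geometric series over `c` turns `p (i 0) (i 1)` into the skeleton kernel.
    have hEc : ∀ c, μ (E c) = (μ {ω | ∀ l ≤ k, Y ω l = w l} *
        (∏ r ∈ Finset.range n, skeletonKernel p (i (r + 1)) (i (r + 1 + 1))) *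
          p (i 0) (i 1)) * p (i 0) (i 0) ^ c := by
      intro c
      have e0 : w' c (k + c + 1) = i 1 := if_neg (by omega)
      have e1 := ih (k + c + 1) (w' c) (fun r => i (r + 1)) e0.symm
        fun r hr => hi (r + 1) (by omega)
      have e2 := hp (k + c) (w' c)
      have e3 : w' c (k + c) = w k := by simp [hw']
      have e4 : {ω | ∀ l ≤ k + c, Y ω l = w' c l} = {ω | ∀ l ≤ k + c, Y ω l = w (min l k)} := by
        ext ω
        simp only [Set.mem_ofPred_eq]
        exact forall₂_congr fun l hl => by rw [hw']; simp [hl]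
      rw [e0, e3, e4, measure_stay hp, ← h0] at e2
      rw [hE, e1, e2]
      ring
    rw [hunion, measure_iUnion hdisj hmeas]
    simp only [hEc]
    rw [ENNReal.tsum_mul_left, ENNReal.tsum_geometric]
    have hK : skeletonKernel p (i 0) (i (0 + 1)) = p (i 0) (i 1) * (1 - p (i 0) (i 0))⁻¹ := by
      simp [skeletonKernel, hz, h1]
    rw [hK]
    ring

end Skeleton

/-! ### Passage from the grid to continuous time -/

/-- The transition matrix of the jump chain of a weighted branching process, stopped at `0`. -/
noncomputable def jumpKernel (b : ℕ → ℝ) (i j : ℕ) : ℝ≥0∞ :=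
  if i = 0 then (if j = 0 then 1 else 0)
  else if j = i ∨ j + 1 < i then 0 else ENNReal.ofReal (b (j + 1 - i) / (-b 1))

/-- Numerator and denominator of `P h i j / (1 - P h i i)` are both of first order in `h`, so the
ratio tends to `q_ij / (-q_ii)`, in which `w i` cancels. -/
lemma tendsto_skeletonKernel {b w : ℕ → ℝ} (hbw : IsData b w) {P : ℝ → ℕ → ℕ → ℝ}
    (hP : IsBranchingTransitionFunction b w P) {h : ℕ → ℝ} (hh : ∀ N, 0 < h N)
    (hh0 : Tendsto h atTop (𝓝 0)) (i j : ℕ) :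
    (∀ᶠ N in atTop, i ≠ 0 → ENNReal.ofReal (P (h N) i i) < 1) ∧
    Tendsto (fun N => skeletonKernel (fun i j => ENNReal.ofReal (P (h N) i j)) i j) atTop
      (𝓝 (jumpKernel b i j)) := by
  by_cases hi : i = 0
  · simp [skeletonKernel, jumpKernel, hi]
  have hlim : Tendsto h atTop (𝓝[>] 0) :=
    tendsto_nhdsWithin_of_tendsto_nhds_of_eventually_within _ hh0 (Eventually.of_forall hh)
  have hslope : ∀ j, Tendsto (fun N => (P (h N) i j - P 0 i j) / h N) atTop
      (𝓝 (qMatrix b w i j)) := by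
    intro j
    have := (hasDerivWithinAt_iff_tendsto_slope' (by simp)).1 (hP.deriv_zero i j).Ioi_of_Ici
    refine (this.comp hlim).congr fun N => ?_
    simp [slope_def_field]
  have hqii : qMatrix b w i i = w i * b 1 := by
    simp [qMatrix, Nat.one_le_iff_ne_zero.2 hi, show i + 1 - i = 1 by omega]
  have hwi := hbw.weight_pos i (Nat.one_le_iff_ne_zero.2 hi)
  have hneg : qMatrix b w i i < 0 := by rw [hqii]; exact mul_neg_of_pos_of_neg hwi hbw.neg
  have hlt : ∀ᶠ N in atTop, P (h N) i i < 1 := by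
    filter_upwards [(hslope i).eventually (gt_mem_nhds hneg)] with N hN
    rw [div_neg_iff] at hN
    rw [hP.zero, if_pos rfl] at hN
    rcases hN with hN | hN
    · exact absurd (hh N) (not_lt.2 hN.2.le)
    · linarith [hN.1]
  refine ⟨hlt.mono fun N hN _ => by simpa using hN, ?_⟩
  by_cases hj : j = i
  · simp [skeletonKernel, jumpKernel, hi, hj]
  have hq : Tendsto (fun N => P (h N) i j / (1 - P (h N) i i)) atTop
      (𝓝 (qMatrix b w i j / -qMatrix b w i i)) := by
    refine ((hslope j).div (hslope i).neg (by linarith)).congr fun N => ?_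
    rw [hP.zero, hP.zero, if_neg (fun h => hj h.symm), if_pos rfl]
    simp only [Pi.div_apply]
    rw [← neg_div, div_div_div_cancel_right₀ (hh N).ne', sub_zero, neg_sub]
  have hval : jumpKernel b i j = ENNReal.ofReal (qMatrix b w i j / -qMatrix b w i i) := by
    have hw0 := hwi.ne'
    have hb0 := hbw.neg.ne
    rw [hqii]
    unfold jumpKernel qMatrix
    by_cases hji : j + 1 < i
    · rw [if_neg hi, if_pos (Or.inr hji), if_neg (by omega)]
      simp
    · rw [if_neg hi, if_neg (by omega), if_pos (by omega)]
      congr 1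
      field_simp
  rw [hval]
  refine (ENNReal.tendsto_ofReal hq).congr' ?_
  filter_upwards [hlt] with N hN
  simp only [skeletonKernel, if_neg hi, if_neg hj]
  rw [ENNReal.ofReal_div_of_pos (by linarith), ENNReal.div_eq_inv_mul, mul_comm,
    ENNReal.ofReal_sub _ (hP.nonneg _ (hh N).le _ _), ENNReal.ofReal_one]

/-- The jump chain of a weighted branching process, stopped at `0`, is a Markov chain with
transition matrix `jumpKernel b`. -/
lemma exists_jumpChain_law {Ω : Type*} [MeasurableSpace Ω] {μ : Measure Ω} [IsProbabilityMeasure μ]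
    {b w : ℕ → ℝ} (hbw : IsData b w) {X : ℝ≥0 → Ω → ℕ} (hX : IsProcess μ b w X)
    (hX0 : ∀ᵐ ω ∂μ, X 0 ω = 1) :
    ∃ Z : ℕ → Ω → ℕ, (∀ n, Measurable (Z n)) ∧
      (∀ᵐ ω ∂μ, ∀ n, Z n ω = jumpChain n fun t => X t ω) ∧
      ∀ (n : ℕ) (i : ℕ → ℕ), μ {ω | ∀ k ≤ n, Z k ω = i k} =
        (if i 0 = 1 then 1 else 0) * ∏ r ∈ Finset.range n, jumpKernel b (i r) (i (r + 1)) := by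
  obtain ⟨⟨P, hP, hMar⟩, hreg⟩ := hX
  set h : ℕ → ℝ≥0 := fun N => 1 / ((N : ℝ≥0) + 1) with hh_def
  have hh : ∀ N, 0 < h N := fun N => by positivity
  have hh0 : Tendsto h atTop (𝓝 0) := tendsto_one_div_add_atTop_nhds_zero_nat
  set Y : ℕ → Ω → ℕ → ℕ := fun N ω k => X (k * h N) ω with hYdef
  have hYm : ∀ N k, Measurable fun ω => Y N ω k := fun N k => hMar.measurable _
  have hZm : ∀ N n, Measurable fun ω => jumpChain n (Y N ω) := fun N n =>
    (measurable_jumpChain n).comp (measurable_pi_lambda _ (hYm N))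
  have hconv : ∀ᵐ ω ∂μ, ∀ n, ∀ᶠ N in atTop,
      jumpChain n (Y N ω) = jumpChain n fun t => X t ω := by
    filter_upwards [hreg] with ω hω n
    have := eventually_jumpChain_sample n (x := fun t => X t ω) hω.1 hh
      (tendsto_const_nhds (x := (0 : ℝ≥0))) hh0
    simpa only [zero_add] using this
  -- The jump chain of `X` is only an almost everywhere limit of measurable maps, so measurable
  -- representatives serve as `Z`.
  have hae : ∀ n, AEMeasurable (fun ω => jumpChain n fun t => X t ω) μ := by
    intro n
    refine aemeasurable_of_tendsto_metrizable_ae atTop (fun N => (hZm N n).aemeasurable) ?_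
    filter_upwards [hconv] with ω hω
    exact tendsto_const_nhds.congr' ((hω n).mono fun N hN => hN.symm)
  have hmk : ∀ᵐ ω ∂μ, ∀ n, (hae n).mk _ ω = jumpChain n fun t => X t ω :=
    ae_all_iff.2 fun n => (hae n).ae_eq_mk.symm
  refine ⟨fun n => (hae n).mk _, fun n => (hae n).measurable_mk, hmk, fun n i => ?_⟩
  -- The cylinder probabilities of the sampled jump chains have two limits: the law of `Z`, by
  -- convergence of the indicators, and the product of the limiting kernels, by the skeleton
  -- formula.
  have hlim1 : Tendsto (fun N => μ {ω | ∀ k ≤ n, jumpChain k (Y N ω) = i k}) atTop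
      (𝓝 (μ {ω | ∀ k ≤ n, (hae k).mk _ ω = i k})) := by
    apply tendsto_measure_of_ae_tendsto_indicator_of_isFiniteMeasure
    · exact measurableSet_forall_eq (fun k => (hae k).measurable_mk) n i
    · exact fun N => measurableSet_forall_eq (hZm N) n i
    · filter_upwards [hconv, hmk] with ω h1 h2
      have : ∀ᶠ N in atTop, ∀ k ∈ Finset.range (n + 1),
          jumpChain k (Y N ω) = jumpChain k fun t => X t ω :=
        (Filter.eventually_all_finset _).2 fun k _ => h1 k
      filter_upwards [this] with N hN
      refine forall₂_congr fun k hk => ?_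
      rw [hN k (by simp; omega), h2 k]
  have hinit : μ {ω | ∀ l ≤ 0, X l ω = i 0} = if i 0 = 1 then 1 else 0 := by
    have : ∀ᵐ ω ∂μ, (ω ∈ {ω | ∀ l ≤ 0, X l ω = i 0} ↔ i 0 = 1) := by
      filter_upwards [hX0] with ω hω
      simp [hω, eq_comm]
    split_ifs with h1
    · rw [← prob_compl_eq_zero_iff₀, ← mem_ae_iff]
      · filter_upwards [this] with ω hω using hω.2 h1
      · apply MeasurableSet.nullMeasurableSet
        simp only [nonpos_iff_eq_zero, forall_eq]
        exact measurableSet_eq_fun (hMar.measurable 0) measurable_const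
    · rw [measure_eq_zero_iff_ae_notMem]
      filter_upwards [this] with ω hω using fun hh => h1 (hω.1 hh)
  have hlim2 : Tendsto (fun N => μ {ω | ∀ k ≤ n, jumpChain k (Y N ω) = i k}) atTop
      (𝓝 ((if i 0 = 1 then 1 else 0) *
        ∏ r ∈ Finset.range n, jumpKernel b (i r) (i (r + 1)))) := by
    have hK := fun r => tendsto_skeletonKernel hbw hP (h := fun N => (h N : ℝ))
      (fun N => NNReal.coe_pos.2 (hh N)) (NNReal.tendsto_coe.2 hh0) (i r) (i (r + 1))
    have hprod := ENNReal.tendsto_finsetProd_of_ne_top (Finset.range n) (fun r _ => (hK r).2)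
      (fun r _ => by unfold jumpKernel; split_ifs <;> simp)
    have hprod' := ENNReal.Tendsto.const_mul (a := if i 0 = 1 then (1 : ℝ≥0∞) else 0) hprod
      (Or.inr (by split_ifs <;> simp))
    refine hprod'.congr' ?_
    have hev : ∀ᶠ N in atTop, ∀ r ∈ Finset.range n,
        i r ≠ 0 → ENNReal.ofReal (P (h N) (i r) (i r)) < 1 :=
      (Filter.eventually_all_finset _).2 fun r _ => (hK r).1
    filter_upwards [hev] with N hN
    have hmar : ∀ (n : ℕ) (i : ℕ → ℕ), μ {ω | ∀ k ≤ n + 1, Y N ω k = i k} =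
        μ {ω | ∀ k ≤ n, Y N ω k = i k} * ENNReal.ofReal (P (h N) (i n) (i (n + 1))) := by
      intro n i
      have := hMar.markov n (fun k => k * h N) i (fun k l hkl => by dsimp only; gcongr)
      have harg : (((n + 1 : ℕ) * h N : ℝ≥0) : ℝ) - ((n * h N : ℝ≥0) : ℝ) = h N := by
        push_cast; ring
      rw [harg] at this
      rw [← ofReal_measureReal, this, ENNReal.ofReal_mul measureReal_nonneg, ofReal_measureReal]
    have := measure_jumpChain_skeleton
      (p := fun i j => ENNReal.ofReal (P (h N) i j)) (hYm N) hmar n 0 (fun _ => i 0) i rfl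
      fun r hr => hN r (Finset.mem_range.2 hr)
    have e1 : {ω | ∀ l ≤ 0, Y N ω l = i 0} = {ω | ∀ l ≤ 0, X l ω = i 0} := by
      ext ω; simp [hYdef]
    rw [e1, hinit] at this
    rw [← this]
    congr 1
    ext ω
    simp only [Set.mem_ofPred_eq, nonpos_iff_eq_zero, forall_eq, zero_add]
    exact ⟨fun h => h.2, fun h => ⟨h 0 (by omega), h⟩⟩
  exact tendsto_nhds_unique hlim1 hlim2

/-! ### Multiplicative martingales of the jump chain -/

section Harmonic

variable {Ω : Type*} [MeasurableSpace Ω] {μ : Measure Ω} {Z : ℕ → Ω → ℕ}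

/-- If `f` is harmonic for the kernel `K i j * g i j`, then
the `g`-weighted expectation of `f` along the chain is constant. -/
lemma setLIntegral_prod_mul_eq {K g : ℕ → ℕ → ℝ≥0∞} {f : ℕ → ℝ≥0∞} (hZ : ∀ n, Measurable (Z n))
    (hK : ∀ (n : ℕ) (i : ℕ → ℕ), μ {ω | ∀ k ≤ n + 1, Z k ω = i k} =
      μ {ω | ∀ k ≤ n, Z k ω = i k} * K (i n) (i (n + 1)))
    (hf : ∀ i, ∑' j, K i j * (g i j * f j) = f i) (d n : ℕ) (i : ℕ → ℕ) :
    ∫⁻ ω in {ω | ∀ k ≤ n, Z k ω = i k},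
        (∏ k ∈ Finset.range d, g (Z (n + k) ω) (Z (n + k + 1) ω)) * f (Z (n + d) ω) ∂μ =
      μ {ω | ∀ k ≤ n, Z k ω = i k} * f (i n) := by
  induction d generalizing n i with
  | zero =>
    rw [setLIntegral_congr_fun (g := fun _ => f (i n)) (measurableSet_forall_eq hZ n i),
      setLIntegral_const, mul_comm]
    intro ω hω
    simp [hω n le_rfl]
  | succ d ih =>
    -- Split by the value of the next state; on each piece the first factor of the product is
    -- constant and the induction hypothesis handles the rest.
    set A : ℕ → Set Ω := fun j => {ω | ∀ k ≤ n + 1, Z k ω = Function.update i (n + 1) j k} with hA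
    have hupd : ∀ j k, k ≤ n → Function.update i (n + 1) j k = i k := fun j k hk =>
      Function.update_of_ne (by omega) _ _
    have hmem : ∀ j ω, ω ∈ A j ↔ (∀ k ≤ n, Z k ω = i k) ∧ Z (n + 1) ω = j := by
      intro j ω
      constructor
      · intro h
        refine ⟨fun k hk => ?_, ?_⟩
        · rw [h k (by omega), hupd j k hk]
        · rw [h _ le_rfl, Function.update_self]
      · rintro ⟨h1, h2⟩ k hk
        rcases hk.lt_or_eq with hk | rfl
        · rw [h1 k (by omega), hupd j k (by omega)]
        · rw [h2, Function.update_self]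
    have hun : {ω | ∀ k ≤ n, Z k ω = i k} = ⋃ j, A j := by
      ext ω
      simp only [Set.mem_iUnion, hmem, Set.mem_ofPred_eq]
      exact ⟨fun h => ⟨_, h, rfl⟩, fun ⟨_, h, _⟩ => h⟩
    have hdisj : Pairwise (Function.onFun Disjoint A) := by
      intro j l hjl
      rw [Function.onFun, Set.disjoint_left]
      intro ω h1 h2
      exact hjl (((hmem j ω).1 h1).2.symm.trans ((hmem l ω).1 h2).2)
    have hAm : ∀ j, MeasurableSet (A j) := fun j => measurableSet_forall_eq hZ _ _
    have hint : ∀ j, ∫⁻ ω in A j,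
        (∏ k ∈ Finset.range (d + 1), g (Z (n + k) ω) (Z (n + k + 1) ω)) * f (Z (n + (d + 1)) ω) ∂μ =
        μ {ω | ∀ k ≤ n, Z k ω = i k} * (K (i n) j * (g (i n) j * f j)) := by
      intro j
      have e1 := ih (n + 1) (Function.update i (n + 1) j)
      have e2 := hK n (Function.update i (n + 1) j)
      have e3 : {ω | ∀ k ≤ n, Z k ω = Function.update i (n + 1) j k} =
          {ω | ∀ k ≤ n, Z k ω = i k} := by
        ext ω
        exact forall₂_congr fun k hk => by rw [hupd j k hk]
      rw [e3, hupd j n le_rfl, Function.update_self] at e2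
      rw [e2, Function.update_self] at e1
      rw [setLIntegral_congr_fun (g := fun ω => g (i n) j *
        ((∏ k ∈ Finset.range d, g (Z (n + 1 + k) ω) (Z (n + 1 + k + 1) ω)) *
          f (Z (n + 1 + d) ω))) (hAm j)]
      · have hg : ∀ k, Measurable fun ω => g (Z (n + 1 + k) ω) (Z (n + 1 + k + 1) ω) := fun k =>
          (measurable_of_countable fun p : ℕ × ℕ => g p.1 p.2).comp ((hZ _).prodMk (hZ _))
        rw [lintegral_const_mul, e1]
        · ring
        · exact (Finset.measurable_fun_prod _ fun k _ => hg k).mul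
            ((measurable_of_countable f).comp (hZ _))
      · intro ω hω
        obtain ⟨h1, h2⟩ := (hmem j ω).1 hω
        simp only []
        rw [Finset.prod_range_succ']
        simp only [add_zero, h1 n le_rfl, h2]
        rw [show n + (d + 1) = n + 1 + d by ring, mul_comm _ (g (i n) j), mul_assoc]
        congr 2
        refine Finset.prod_congr rfl fun k _ => ?_
        rw [show n + (k + 1) = n + 1 + k by ring]
    rw [hun, lintegral_iUnion hAm hdisj]
    simp only [hint]
    rw [ENNReal.tsum_mul_left, hf, ← hun]

end Harmonic

lemma jumpKernel_add {b : ℕ → ℝ} (i l : ℕ) :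
    jumpKernel b (i + 1) (i + l) = if l = 1 then 0 else ENNReal.ofReal (b l / (-b 1)) := by
  unfold jumpKernel
  rw [if_neg (by omega)]
  by_cases h : l = 1
  · simp [h]
  · rw [if_neg (by omega), if_neg h, show i + l + 1 - (i + 1) = l by omega]

/-- Powers of a root of a generating function equation are harmonic for the jump chain. -/
lemma tsum_jumpKernel {b w : ℕ → ℝ} (hbw : IsData b w) {c : ℕ → ℝ} (hc : ∀ l, 0 ≤ c l) {v : ℝ}
    (hv : 0 ≤ v) (hsum : HasSum (fun l => if l = 1 then 0 else b l * c l * v ^ l) (-b 1 * v))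
    {g : ℕ → ℕ → ℝ≥0∞} (hg0 : g 0 0 = 1) (hg : ∀ i l, g (i + 1) (i + l) = ENNReal.ofReal (c l))
    (i : ℕ) :
    ∑' j, jumpKernel b i j * (g i j * ENNReal.ofReal v ^ j) = ENNReal.ofReal v ^ i := by
  cases i with
  | zero =>
    rw [tsum_eq_single 0]
    · simp [jumpKernel, hg0]
    · intro j hj; simp [jumpKernel, hj]
  | succ i =>
    -- The chain descends by at most one, so the targets from `i + 1` are `i + l`, reached when one
    -- individual is replaced by `l`.
    have hsupp : Function.support (fun j => jumpKernel b (i + 1) j *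
        (g (i + 1) j * ENNReal.ofReal v ^ j)) ⊆ Set.range (i + ·) := by
      intro j hj
      refine ⟨j - i, ?_⟩
      by_contra hne
      apply hj
      have : jumpKernel b (i + 1) j = 0 := by
        unfold jumpKernel
        rw [if_neg (by omega), if_pos]
        right
        simp only at hne
        omega
      simp [this]
    rw [← (add_right_injective i).tsum_eq hsupp]
    have hb := hbw.neg
    have hterm : ∀ l, jumpKernel b (i + 1) (i + l) * (g (i + 1) (i + l) * ENNReal.ofReal v ^ (i + l)) =
        ENNReal.ofReal v ^ i *
          ENNReal.ofReal ((if l = 1 then 0 else b l * c l * v ^ l) / (-b 1)) := by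
      intro l
      rw [jumpKernel_add, hg, pow_add]
      by_cases hl : l = 1
      · simp [hl]
      · rw [if_neg hl, if_neg hl, ← ENNReal.ofReal_pow hv l]
        have : b l * c l * v ^ l / (-b 1) = b l / (-b 1) * (c l * v ^ l) := by ring
        rw [this, ENNReal.ofReal_mul (div_nonneg (hbw.nonneg l hl) (by linarith)),
          ENNReal.ofReal_mul (hc l)]
        ring
    simp only [hterm]
    rw [ENNReal.tsum_mul_left, ← ENNReal.ofReal_tsum_of_nonneg, (hsum.div_const (-b 1)).tsum_eq,
      mul_div_cancel_left₀ _ (by linarith), pow_succ]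
    · intro l
      apply div_nonneg _ (by linarith)
      split_ifs with h
      · exact le_rfl
      · exact mul_nonneg (mul_nonneg (hbw.nonneg l h) (hc l)) (pow_nonneg hv l)
    · exact hsum.summable.div_const _

/-! ### Almost sure extinction and the generating function of the step count -/

section Chain

variable {Ω : Type*} [MeasurableSpace Ω] {μ : Measure Ω} [IsProbabilityMeasure μ]
  {Z : ℕ → Ω → ℕ} {b w : ℕ → ℝ}

/-- The chain starts at `1` almost surely, so the constant expectation is `v ^ 1`. The weight `c l`
is attached to each step with `l` offspring. -/
lemma lintegral_prod_mul_pow (hbw : IsData b w) (hZ : ∀ n, Measurable (Z n))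
    (hlaw : ∀ (n : ℕ) (i : ℕ → ℕ), μ {ω | ∀ k ≤ n, Z k ω = i k} =
      (if i 0 = 1 then 1 else 0) * ∏ r ∈ Finset.range n, jumpKernel b (i r) (i (r + 1)))
    {c : ℕ → ℝ} (hc : ∀ l, 0 ≤ c l) {v : ℝ} (hv : 0 ≤ v)
    (hsum : HasSum (fun l => if l = 1 then 0 else b l * c l * v ^ l) (-b 1 * v))
    {g : ℕ → ℕ → ℝ≥0∞} (hg0 : g 0 0 = 1) (hg : ∀ i l, g (i + 1) (i + l) = ENNReal.ofReal (c l))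
    (n : ℕ) :
    ∫⁻ ω, (∏ k ∈ Finset.range n, g (Z k ω) (Z (k + 1) ω)) * ENNReal.ofReal v ^ Z n ω ∂μ =
      ENNReal.ofReal v := by
  have h := setLIntegral_prod_mul_eq (K := jumpKernel b) (g := g)
    (f := fun j => ENNReal.ofReal v ^ j) hZ
    (fun n i => by rw [hlaw, hlaw, Finset.prod_range_succ, mul_assoc])
    (tsum_jumpKernel hbw hc hv hsum hg0 hg) n 0 fun _ => 1
  have h1 : μ {ω | ∀ k ≤ 0, Z k ω = 1} = 1 := by simpa using hlaw 0 fun _ => 1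
  rw [h1, Measure.restrict_eq_self_of_ae_mem] at h
  · simpa using h
  · have : {ω | ∀ k ≤ 0, Z k ω = 1} ∈ ae μ := by
      rw [mem_ae_iff, prob_compl_eq_zero_iff (measurableSet_forall_eq hZ 0 _)]
      exact h1
    exact this

/-- If `B > 0` on `(0, 1)`, the jump chain reaches `0`. -/
lemma ae_exists_eq_zero (hbw : IsData b w) (hZ : ∀ n, Measurable (Z n))
    (hlaw : ∀ (n : ℕ) (i : ℕ → ℕ), μ {ω | ∀ k ≤ n, Z k ω = i k} =
      (if i 0 = 1 then 1 else 0) * ∏ r ∈ Finset.range n, jumpKernel b (i r) (i (r + 1)))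
    (hpos : ∀ v, 0 < v → v < 1 →
      ∃ S, HasSum (fun l => if l = 1 then 0 else b l * v ^ l) S ∧ -b 1 * v < S) :
    ∀ᵐ ω ∂μ, ∃ n, Z n ω = 0 := by
  have hH : MeasurableSet {ω | ∃ n, Z n ω = 0} := by
    have : {ω | ∃ n, Z n ω = 0} = ⋃ n, {ω | Z n ω = 0} := by ext; simp
    rw [this]
    exact MeasurableSet.iUnion fun n => measurableSet_eq_fun (hZ n) measurable_const
  have hb := hbw.neg
  have key : ∀ v, 0 < v → v < 1 → ENNReal.ofReal v ≤ μ {ω | ∃ n, Z n ω = 0} := by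
    intro v hv0 hv1
    obtain ⟨S, hS, hlt⟩ := hpos v hv0 hv1
    have hbv : 0 < -b 1 * v := mul_pos (by linarith) hv0
    have hS0 : 0 < S := hbv.trans hlt
    -- The factor `θ` makes `v` solve the harmonic equation when every step from a nonzero state
    -- carries weight `θ`; `B(v) > 0` gives `θ < 1`. Survival up to time `n` then contributes at
    -- most `θ ^ n` to the expectation `v`, so the chain hits `0` with probability at least `v`, for
    -- each `v < 1`.
    set θ := -b 1 * v / S with hθ
    have hθ0 : 0 < θ := div_pos hbv hS0
    have hθ1 : θ < 1 := (div_lt_one hS0).2 hlt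
    have hsum : HasSum (fun l => if l = 1 then 0 else b l * (fun _ => θ) l * v ^ l) (-b 1 * v) := by
      have := hS.mul_left θ
      rw [hθ, div_mul_cancel₀ _ hS0.ne', ← hθ] at this
      refine this.congr_fun fun l => ?_
      split_ifs
      · simp
      · ring
    have hE := fun n => lintegral_prod_mul_pow hbw hZ hlaw (fun _ => hθ0.le) hv0.le hsum
      (g := fun i _ => if i = 0 then 1 else ENNReal.ofReal θ) (by simp) (by simp) n
    have hbound : ∀ n, ENNReal.ofReal v ≤ μ {ω | ∃ n, Z n ω = 0} + ENNReal.ofReal θ ^ n := by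
      intro n
      rw [← hE n]
      calc _ ≤ ∫⁻ ω, ({ω | ∃ n, Z n ω = 0}.indicator 1 ω + ENNReal.ofReal θ ^ n) ∂μ := by
            refine lintegral_mono fun ω => ?_
            have hu : ENNReal.ofReal v ^ Z n ω ≤ 1 :=
              pow_le_one₀ zero_le (by simpa using hv1.le)
            by_cases hω : ∃ n, Z n ω = 0
            · have : ω ∈ {ω | ∃ n, Z n ω = 0} := hω
              simp only [Set.indicator_of_mem this, Pi.one_apply]
              refine le_trans ?_ le_self_add
              refine mul_le_one' (Finset.prod_le_one' fun k _ => ?_) hu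
              split_ifs
              · exact le_rfl
              · simpa using hθ1.le
            · have : ω ∉ {ω | ∃ n, Z n ω = 0} := hω
              push Not at hω
              simp only [Set.indicator_of_notMem this, zero_add, hω, if_false, Finset.prod_const,
                Finset.card_range]
              exact mul_le_of_le_one_right' hu
        _ = _ := by
            rw [lintegral_add_right _ measurable_const, lintegral_indicator_one hH]
            simp
    have hlim : Tendsto (fun n => μ {ω | ∃ n, Z n ω = 0} + ENNReal.ofReal θ ^ n) atTop
        (𝓝 (μ {ω | ∃ n, Z n ω = 0} + 0)) :=
      tendsto_const_nhds.add
        (ENNReal.tendsto_pow_atTop_nhds_zero_of_lt_one (by simpa using hθ1))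
    rw [add_zero] at hlim
    exact ge_of_tendsto' hlim hbound
  have hone : 1 ≤ μ {ω | ∃ n, Z n ω = 0} := by
    have hlim : Tendsto (fun v : ℝ => ENNReal.ofReal v) (𝓝[<] 1) (𝓝 (ENNReal.ofReal 1)) :=
      (ENNReal.continuous_ofReal.tendsto 1).mono_left nhdsWithin_le_nhds
    rw [ENNReal.ofReal_one] at hlim
    refine le_of_tendsto hlim ?_
    filter_upwards [Ioo_mem_nhdsLT (zero_lt_one' ℝ)] with v hv using key v hv.1 hv.2
  rw [Filter.Eventually, mem_ae_iff, prob_compl_eq_zero_iff hH]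
  exact le_antisymm prob_le_one hone

/-- The number of steps of size `m - 1` among the first `n` steps of a chain. -/
def stepCount (m : ℕ) (z : ℕ → ℕ) (n : ℕ) : ℕ :=
  ((Finset.range n).filter fun k => z (k + 1) + 1 = z k + m).card

/-- After absorption all steps are `0 → 0`, which are not counted because `m ≠ 1`; hence the count
freezes at the hitting time. -/
lemma stepCount_eventually {m : ℕ} (hm : m ≠ 1) {z : ℕ → ℕ}
    (habs : ∀ n, z n = 0 → z (n + 1) = 0) {N : ℕ} (hN : z N = 0) :
    (∀ n, N ≤ n → z n = 0 ∧ stepCount m z n = stepCount m z N) ∧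
      {k | z (k + 1) + 1 = z k + m}.encard = stepCount m z N := by
  have hz : ∀ n, N ≤ n → z n = 0 := fun n hn => by
    induction n, hn using Nat.le_induction with
    | base => exact hN
    | succ n _ ih => exact habs n ih
  have hlt : ∀ k, z (k + 1) + 1 = z k + m → k < N := fun k hk => by
    by_contra h
    rw [hz k (by omega), hz (k + 1) (by omega)] at hk
    omega
  refine ⟨fun n hn => ⟨hz n hn, ?_⟩, ?_⟩
  · unfold stepCount
    congr 1
    ext k
    simp only [Finset.mem_filter, Finset.mem_range]
    exact ⟨fun h => ⟨hlt k h.2, h.2⟩, fun h => ⟨by omega, h.2⟩⟩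
  · unfold stepCount
    rw [← Set.encard_coe_eq_coe_finsetCard]
    congr 1
    ext k
    simp only [Finset.coe_filter, Finset.mem_range, Set.mem_ofPred_eq]
    exact ⟨fun h => ⟨hlt k h, h⟩, fun h => h.2⟩

lemma measurable_stepCount (hZ : ∀ n, Measurable (Z n)) (m n : ℕ) :
    Measurable fun ω => stepCount m (fun k => Z k ω) n := by
  have : (fun ω => stepCount m (fun k => Z k ω) n) = fun ω =>
      ∑ k ∈ Finset.range n, if Z (k + 1) ω + 1 = Z k ω + m then 1 else 0 := by
    ext ω
    unfold stepCount
    rw [Finset.card_filter]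
  rw [this]
  refine Finset.measurable_fun_sum _ fun k _ => ?_
  exact Measurable.ite (measurableSet_eq_fun ((hZ _).add_const 1) ((hZ _).add_const m))
    measurable_const measurable_const

/-- The generating function of the total number of steps of size `m - 1`. -/
lemma lintegral_pow_stepCount (hbw : IsData b w) (hZ : ∀ n, Measurable (Z n))
    (hlaw : ∀ (n : ℕ) (i : ℕ → ℕ), μ {ω | ∀ k ≤ n, Z k ω = i k} =
      (if i 0 = 1 then 1 else 0) * ∏ r ∈ Finset.range n, jumpKernel b (i r) (i (r + 1)))
    {m : ℕ} (hm : m ≠ 1) {Y : Ω → ℕ}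
    (hY : ∀ᵐ ω ∂μ, ∀ᶠ n in atTop, Z n ω = 0 ∧ stepCount m (fun k => Z k ω) n = Y ω)
    {s v : ℝ} (hs0 : 0 ≤ s) (hs1 : s ≤ 1) (hv0 : 0 ≤ v) (hv1 : v ≤ 1)
    (hsum : HasSum (fun l => if l = 1 then 0 else b l * (if l = m then s else 1) * v ^ l)
      (-b 1 * v)) :
    ∫⁻ ω, ENNReal.ofReal s ^ Y ω ∂μ = ENNReal.ofReal v := by
  set g : ℕ → ℕ → ℝ≥0∞ := fun i j => if j + 1 = i + m then ENNReal.ofReal s else 1 with hg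
  have hE := fun n => lintegral_prod_mul_pow hbw hZ hlaw (c := fun l => if l = m then s else 1)
    (fun l => by split_ifs <;> linarith) hv0 hsum (g := g)
    (by simp only [hg]; rw [if_neg (by omega)])
    (fun i l => by
      simp only [hg]
      by_cases h : l = m
      · rw [if_pos (by omega), if_pos h]
      · rw [if_neg (by omega), if_neg h, ENNReal.ofReal_one]) n
  have hprod : ∀ n ω, ∏ k ∈ Finset.range n, g (Z k ω) (Z (k + 1) ω) =
      ENNReal.ofReal s ^ stepCount m (fun k => Z k ω) n := by
    intro n ω
    simp only [hg, stepCount]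
    rw [Finset.prod_ite]
    simp
  simp only [hprod] at hE
  have hs' : ENNReal.ofReal s ≤ 1 := by simpa using hs1
  have hv' : ENNReal.ofReal v ≤ 1 := by simpa using hv1
  have hlim := tendsto_lintegral_of_dominated_convergence (μ := μ)
    (F := fun n ω => ENNReal.ofReal s ^ stepCount m (fun k => Z k ω) n * ENNReal.ofReal v ^ Z n ω)
    (f := fun ω => ENNReal.ofReal s ^ Y ω) (fun _ => 1)
    (fun n => ((measurable_of_countable fun k => ENNReal.ofReal s ^ k).comp
      (measurable_stepCount hZ m n)).mul
        ((measurable_of_countable fun k => ENNReal.ofReal v ^ k).comp (hZ n)))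
    (fun n => Eventually.of_forall fun ω =>
      mul_le_one' (pow_le_one₀ zero_le hs') (pow_le_one₀ zero_le hv'))
    (by simp) ?_
  · simp only [hE] at hlim
    exact (tendsto_nhds_unique hlim tendsto_const_nhds).symm ▸ rfl
  · filter_upwards [hY] with ω hω
    refine tendsto_const_nhds.congr' ?_
    filter_upwards [hω] with n hn
    rw [hn.1, hn.2, pow_zero, mul_one]

end Chain

/-! ### The minimal root of `B`, the sign of `B'(1)`, and roots of the marked equation -/

section Roots

lemma summable_mul_pow {β : ℕ → ℝ} (hβ : Summable fun j => |β j|) {u : ℝ} (hu : u ∈ Set.Icc 0 1) :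
    Summable fun j => β j * u ^ j := by
  refine Summable.of_norm_bounded hβ fun j => ?_
  rw [norm_mul, norm_pow, Real.norm_eq_abs, Real.norm_of_nonneg hu.1]
  exact mul_le_of_le_one_right (abs_nonneg _) (pow_le_one₀ hu.1 hu.2)

lemma continuousOn_tsum_mul_pow {β : ℕ → ℝ} (hβ : Summable fun j => |β j|) :
    ContinuousOn (fun u : ℝ => ∑' j, β j * u ^ j) (Set.Icc 0 1) := by
  refine continuousOn_tsum (fun j => by fun_prop) hβ fun j u hu => ?_
  rw [norm_mul, norm_pow, Real.norm_eq_abs, Real.norm_of_nonneg hu.1]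
  exact mul_le_of_le_one_right (abs_nonneg _) (pow_le_one₀ hu.1 hu.2)

lemma tsum_mul_zero_pow (β : ℕ → ℝ) : ∑' j, β j * (0 : ℝ) ^ j = β 0 := by
  rw [tsum_eq_single 0]
  · simp
  · intro j hj; simp [hj]

variable {b w : ℕ → ℝ}

lemma IsData.summable_abs (hbw : IsData b w) : Summable fun j => |b j| := by
  have h := hbw.hasSum.summable.add (hasSum_ite_eq 1 |b 1|).summable
  refine h.congr fun j => ?_
  by_cases hj : j = 1
  · simp [hj]
  · simp [hj, abs_of_nonneg (hbw.nonneg j hj)]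

lemma IsData.hasSum_zero (hbw : IsData b w) : HasSum b 0 := by
  have h := hbw.hasSum.add (hasSum_ite_eq 1 (b 1))
  rw [neg_add_cancel] at h
  refine h.congr_fun fun j => ?_
  by_cases hj : j = 1 <;> simp [hj]

lemma hasSum_ne_one {β : ℕ → ℝ} (hβ : Summable fun j => |β j|) {u : ℝ} (hu : u ∈ Set.Icc 0 1) :
    HasSum (fun l => if l = 1 then 0 else β l * u ^ l) (∑' j, β j * u ^ j - β 1 * u) := by
  have h := (summable_mul_pow hβ hu).hasSum.sub (hasSum_ite_eq 1 (β 1 * u))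
  refine h.congr_fun fun j => ?_
  by_cases hj : j = 1 <;> simp [hj]

/-- `B(0) = b 0 ≥ 0` and `B` has no zero in `[0, 1)`, so by the intermediate value theorem it cannot
become nonpositive there. -/
lemma genFun_pos_of_minRoot (hbw : IsData b w) (h : minRoot (genFun b) = 1) {u : ℝ} (hu0 : 0 ≤ u)
    (hu1 : u < 1) : 0 < genFun b u := by
  have hne : ∀ v, 0 ≤ v → v < 1 → genFun b v ≠ 0 := by
    intro v hv0 hv1 hv
    have : minRoot (genFun b) ≤ v := csInf_le ⟨0, fun x hx => hx.1⟩ ⟨hv0, hv⟩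
    linarith
  have h0 : genFun b 0 = b 0 := tsum_mul_zero_pow b
  by_contra hcon
  have hivt := intermediate_value_Icc' (f := genFun b) hu0
    ((continuousOn_tsum_mul_pow hbw.summable_abs).mono (Set.Icc_subset_Icc_right hu1.le))
  obtain ⟨v, hv, hv'⟩ := hivt ⟨not_lt.1 hcon, by rw [h0]; exact hbw.nonneg 0 (by norm_num)⟩
  exact hne v hv.1 (hv.2.trans_lt hu1) hv'

lemma minRoot_of_genFun_pos (hbw : IsData b w) (h : ∀ u, 0 ≤ u → u < 1 → 0 < genFun b u) :
    minRoot (genFun b) = 1 := by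
  have h1 : genFun b 1 = 0 := by simp [genFun, hbw.hasSum_zero.tsum_eq]
  have hmem : (1 : ℝ) ∈ {u : ℝ | 0 ≤ u ∧ genFun b u = 0} := ⟨zero_le_one, h1⟩
  apply le_antisymm (csInf_le ⟨0, fun x hx => hx.1⟩ hmem)
  refine le_csInf ⟨1, hmem⟩ fun u hu => ?_
  by_contra hlt
  exact (h u hu.1 (not_le.1 hlt)).ne' hu.2

lemma hasSum_one_sub_pow (hbw : IsData b w) {u : ℝ} (hu : u ∈ Set.Icc 0 1) :
    HasSum (fun j => b j * (1 - u ^ j)) (-genFun b u) := by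
  have h := hbw.hasSum_zero.sub (summable_mul_pow hbw.summable_abs hu).hasSum
  rw [zero_sub] at h
  exact h.congr_fun fun j => by ring

/-- Since `B(1) = 0`, one has `-B(u) = ∑ b_j (1 - u^j)`. Dividing by `1 - u` and letting `u → 1`
bounds the partial sums of `∑ j b_j`. Taking `J ≥ 2` puts the only negative coefficient inside the
partial sum, so that dropping the tail is legitimate. -/
lemma derivOneNonpos_of_genFun_pos (hbw : IsData b w) (h : ∀ u, 0 ≤ u → u < 1 → 0 < genFun b u) :
    DerivOneNonpos b := by
  have hpart : ∀ J, 2 ≤ J → ∑ j ∈ Finset.range J, (j : ℝ) * b j ≤ 0 := by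
    intro J hJ
    have hlt : ∀ u : ℝ, 0 ≤ u → u < 1 →
        ∑ j ∈ Finset.range J, b j * ∑ i ∈ Finset.range j, u ^ i ≤ 0 := by
      intro u hu0 hu1
      have hs := hasSum_one_sub_pow hbw ⟨hu0, hu1.le⟩
      have hle := sum_le_hasSum (Finset.range J) (fun j hj => mul_nonneg
        (hbw.nonneg j (by rw [Finset.mem_range] at hj; omega))
        (sub_nonneg.2 (pow_le_one₀ hu0 hu1.le))) hs
      have heq : ∑ j ∈ Finset.range J, b j * (1 - u ^ j) =
          (∑ j ∈ Finset.range J, b j * ∑ i ∈ Finset.range j, u ^ i) * (1 - u) := by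
        rw [Finset.sum_mul]
        refine Finset.sum_congr rfl fun j _ => ?_
        rw [mul_assoc, geom_sum_mul_neg]
      rw [heq] at hle
      have := h u hu0 hu1
      by_contra hcon
      have := mul_pos (not_le.1 hcon) (sub_pos.2 hu1)
      linarith
    have hcont : Continuous fun u : ℝ =>
        ∑ j ∈ Finset.range J, b j * ∑ i ∈ Finset.range j, u ^ i := by fun_prop
    have hlim := (hcont.tendsto 1).mono_left (nhdsWithin_le_nhds (s := Set.Iio 1))
    have := le_of_tendsto hlim (by
      filter_upwards [Ioo_mem_nhdsLT (zero_lt_one' ℝ)] with v hv using hlt v hv.1.le hv.2)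
    simpa [mul_comm] using this
  have hsum0 : Summable fun j : ℕ => if j = 1 then 0 else (j : ℝ) * b j := by
    -- Without its `j = 1` term `b 1`, a nonpositive partial sum is at most `-b 1`. The range is
    -- enlarged to `n + 2` so that it contains `1`.
    refine summable_of_sum_range_le (c := -b 1) (fun j => ?_) fun n => ?_
    · split_ifs with hj
      · exact le_rfl
      · exact mul_nonneg (Nat.cast_nonneg _) (hbw.nonneg j hj)
    · have hnn : ∀ j : ℕ, 0 ≤ if j = 1 then 0 else (j : ℝ) * b j := fun j => by
        split_ifs with hj
        · exact le_rfl
        · exact mul_nonneg (Nat.cast_nonneg _) (hbw.nonneg j hj)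
      calc _ ≤ ∑ j ∈ Finset.range (n + 2), (if j = 1 then 0 else (j : ℝ) * b j) :=
            Finset.sum_le_sum_of_subset_of_nonneg (Finset.range_mono (by omega))
              fun j _ _ => hnn j
        _ = ∑ j ∈ Finset.range (n + 2), ((j : ℝ) * b j - if j = 1 then b 1 else 0) := by
            refine Finset.sum_congr rfl fun j _ => ?_
            by_cases hj : j = 1 <;> simp [hj]
        _ ≤ _ := by
            rw [Finset.sum_sub_distrib, Finset.sum_ite_eq' (Finset.range (n + 2)) 1,
              if_pos (by simp)]
            linarith [hpart (n + 2) (by omega)]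
  have hsum : Summable fun j : ℕ => (j : ℝ) * b j := by
    refine (hsum0.add (hasSum_ite_eq 1 (b 1)).summable).congr fun j => ?_
    by_cases hj : j = 1 <;> simp [hj]
  refine ⟨hsum, le_of_tendsto hsum.hasSum.tendsto_sum_nat ?_⟩
  filter_upwards [eventually_ge_atTop 2] with J hJ using hpart J hJ

lemma one_sub_pow_lt {u : ℝ} (hu0 : 0 ≤ u) (hu1 : u < 1) {j : ℕ} (hj : 2 ≤ j) :
    1 - u ^ j < j * (1 - u) := by
  have h := one_add_mul_self_lt_rpow_one_add (s := u - 1) (by linarith) (by linarith)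
    (p := j) (by exact_mod_cast hj)
  rw [add_sub_cancel, Real.rpow_natCast] at h
  linarith

/-- Bernoulli's inequality, termwise, gives `-B(u) ≤ (1 - u) B'(1) ≤ 0`. The first inequality is
strict if some `b j > 0` with `j ≥ 2`; otherwise `B'(1) = b 1 < 0` and the second one is strict. -/
lemma genFun_pos_of_derivOneNonpos (hbw : IsData b w) (h : DerivOneNonpos b) {u : ℝ} (hu0 : 0 ≤ u)
    (hu1 : u < 1) : 0 < genFun b u := by
  have hs := hasSum_one_sub_pow hbw ⟨hu0, hu1.le⟩
  have hd := h.1.hasSum.mul_left (1 - u)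
  have hle : ∀ j, b j * (1 - u ^ j) ≤ (1 - u) * (j * b j) := by
    intro j
    rcases lt_or_ge j 2 with hj | hj
    · interval_cases j
      · simp
      · simp [mul_comm]
    · have := mul_le_mul_of_nonneg_left (one_sub_pow_lt hu0 hu1 hj).le
        (hbw.nonneg j (by omega))
      linarith
  have hneg : (1 - u) * ∑' j : ℕ, (j : ℝ) * b j ≤ 0 :=
    mul_nonpos_of_nonneg_of_nonpos (by linarith) h.2
  by_cases hex : ∃ j, 2 ≤ j ∧ 0 < b j
  · obtain ⟨j, hj, hbj⟩ := hex
    have hlt := hasSum_lt hle (i := j) (by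
      have := mul_lt_mul_of_pos_left (one_sub_pow_lt hu0 hu1 hj) hbj
      linarith) hs hd
    linarith
  · push Not at hex
    have hval : ∑' j : ℕ, (j : ℝ) * b j = b 1 := by
      rw [tsum_eq_single 1]
      · simp
      · intro j hj
        rcases Nat.lt_or_ge j 2 with h2 | h2
        · have : j = 0 := by omega
          simp [this]
        · rw [le_antisymm (hex j h2) (hbw.nonneg j hj), mul_zero]
    have hle' := hasSum_le hle hs hd
    rw [hval] at hle'
    have := mul_neg_of_pos_of_neg (sub_pos.2 hu1) hbw.neg
    linarith

lemma minRoot_genFun_eq_one_iff (hbw : IsData b w) :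
    minRoot (genFun b) = 1 ↔ DerivOneNonpos b :=
  ⟨fun h => derivOneNonpos_of_genFun_pos hbw fun _ => genFun_pos_of_minRoot hbw h,
    fun h => minRoot_of_genFun_pos hbw fun _ => genFun_pos_of_derivOneNonpos hbw h⟩

lemma summable_abs_mul_marked (hbw : IsData b w) (m : ℕ) {s : ℝ} (hs0 : 0 ≤ s) (hs1 : s ≤ 1) :
    Summable fun j => |b j * if j = m then s else 1| := by
  refine Summable.of_nonneg_of_le (fun j => abs_nonneg _) (fun j => ?_) hbw.summable_abs
  rw [abs_mul]
  refine mul_le_of_le_one_right (abs_nonneg _) ?_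
  split_ifs
  · rwa [abs_of_nonneg hs0]
  · simp

/-- The equation `∑_{j ≠ m} bⱼ vʲ + s b_m vᵐ = 0` has a root in `[0, 1]`. -/
lemma exists_root_marked (hbw : IsData b w) {m : ℕ} (hbm : 0 < b m) {s : ℝ} (hs0 : 0 ≤ s)
    (hs1 : s ≤ 1) :
    ∃ v ∈ Set.Icc (0 : ℝ) 1, ∑' j, (b j * if j = m then s else 1) * v ^ j = 0 := by
  have hivt := intermediate_value_Icc' (zero_le_one' ℝ)
    (continuousOn_tsum_mul_pow (summable_abs_mul_marked hbw m hs0 hs1))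
  have h1 : ∑' j, (b j * if j = m then s else 1) * (1 : ℝ) ^ j ≤ 0 := by
    have h := hbw.hasSum_zero.sub (hasSum_ite_eq m (b m * (1 - s)))
    have h' : ∑' j, (b j * if j = m then s else 1) * (1 : ℝ) ^ j = 0 - b m * (1 - s) := by
      rw [← h.tsum_eq]
      refine tsum_congr fun j => ?_
      by_cases hj : j = m
      · simp only [hj, if_true, one_pow]; ring
      · simp [hj]
    rw [h']
    nlinarith
  have h0 : 0 ≤ ∑' j, (b j * if j = m then s else 1) * (0 : ℝ) ^ j := by
    rw [tsum_mul_zero_pow]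
    refine mul_nonneg (hbw.nonneg 0 (by norm_num)) ?_
    split_ifs <;> linarith
  exact hivt ⟨h1, h0⟩

end Roots

/-! ### Convolution powers as coefficients of powers of power series -/

section Convolution

lemma convPow_zero (f : ℕ → ℝ) (l : ℕ) : convPow f 0 l = if l = 0 then 1 else 0 := by
  cases l <;> simp [convPow]

lemma convPow_succ (f : ℕ → ℝ) (j l : ℕ) :
    convPow f (j + 1) l = ∑ p ∈ Finset.HasAntidiagonal.antidiagonal l, f p.1 * convPow f j p.2 := by
  unfold convPow
  simp only [Finset.mul_sum]
  rw [Finset.sum_sigma']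
  refine Finset.sum_bij'
    (fun x _ => (⟨(x 0, ∑ i, Fin.tail x i), Fin.tail x⟩ : (_ : ℕ × ℕ) × (Fin j → ℕ)))
    (fun q _ => Fin.cons q.1.1 q.2) ?_ ?_ ?_ ?_ ?_
  · intro x hx
    rw [Finset.Nat.mem_antidiagonalTuple, Fin.sum_univ_succ] at hx
    simp only [Finset.mem_sigma, Finset.HasAntidiagonal.mem_antidiagonal, Finset.Nat.mem_antidiagonalTuple,
      and_true]
    exact hx
  · rintro ⟨⟨p, q⟩, y⟩ h
    simp only [Finset.mem_sigma, Finset.HasAntidiagonal.mem_antidiagonal, Finset.Nat.mem_antidiagonalTuple] at h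
    rw [Finset.Nat.mem_antidiagonalTuple, Fin.sum_univ_succ]
    simp only [Fin.cons_zero, Fin.cons_succ]
    rw [h.2, h.1]
  · intro x _
    exact Fin.cons_self_tail x
  · rintro ⟨⟨p, q⟩, y⟩ h
    simp only [Finset.mem_sigma, Finset.HasAntidiagonal.mem_antidiagonal, Finset.Nat.mem_antidiagonalTuple] at h
    simp [h.2]
  · intro x _
    rw [Fin.prod_univ_succ]
    rfl

lemma convPow_eq_coeff (f : ℕ → ℝ) (j l : ℕ) :
    convPow f j l = PowerSeries.coeff l (PowerSeries.mk f ^ j) := by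
  induction j generalizing l with
  | zero => rw [convPow_zero, pow_zero, PowerSeries.coeff_one]
  | succ j ih =>
    rw [convPow_succ, pow_succ', PowerSeries.coeff_mul]
    exact Finset.sum_congr rfl fun p _ => by rw [ih, PowerSeries.coeff_mk]

lemma convPow_zero_right (f : ℕ → ℝ) (j : ℕ) : convPow f j 0 = f 0 ^ j := by
  rw [convPow_eq_coeff, PowerSeries.coeff_zero_eq_constantCoeff_apply, map_pow]
  simp

lemma convPow_one_left (f : ℕ → ℝ) (l : ℕ) : convPow f 1 l = f l := by
  rw [convPow_eq_coeff, pow_one, PowerSeries.coeff_mk]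

lemma convPow_nonneg {f : ℕ → ℝ} (hf : ∀ k, 0 ≤ f k) (j l : ℕ) : 0 ≤ convPow f j l :=
  Finset.sum_nonneg fun _ _ => Finset.prod_nonneg fun _ _ => hf _

lemma convPow_of_lt {f : ℕ → ℝ} (h0 : f 0 = 0) {j l : ℕ} (h : l < j) : convPow f j l = 0 := by
  rw [convPow_eq_coeff]
  have hX : PowerSeries.X ∣ PowerSeries.mk f := PowerSeries.X_dvd_iff.2 (by simpa using h0)
  exact PowerSeries.X_pow_dvd_iff.1 (pow_dvd_pow_of_dvd hX j) l h

/-- The dependence of the `n`-th coefficient of a power on the `n`-th coefficient of the base. -/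
lemma convPow_eq_add {f g : ℕ → ℝ} {n : ℕ} (hn : 0 < n) (hfg : ∀ l < n, g l = f l) (hg : g n = 0)
    (j : ℕ) : convPow f j n = j * f 0 ^ (j - 1) * f n + convPow g j n := by
  obtain ⟨h, hh⟩ : (PowerSeries.X : PowerSeries ℝ) ^ n ∣ PowerSeries.mk f - PowerSeries.mk g := by
    rw [PowerSeries.X_pow_dvd_iff]
    intro l hl
    simp [hfg l hl]
  have hf : PowerSeries.mk f = PowerSeries.mk g + PowerSeries.X ^ n * h := by
    rw [← hh]; ring
  have hcoeff : PowerSeries.constantCoeff h = f n := by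
    have := congrArg (PowerSeries.coeff n) hh
    rw [PowerSeries.coeff_X_pow_mul', if_pos le_rfl, Nat.sub_self] at this
    simpa [hg] using this.symm
  -- Expand the power to second order in `X ^ n * h`. The quadratic remainder is divisible by `X ^
  -- (2 * n)` and does not reach the `n`-th coefficient.
  obtain ⟨k, hk⟩ := Polynomial.powAddExpansion (PowerSeries.mk g) (PowerSeries.X ^ n * h) j
  rw [convPow_eq_coeff, hf, hk, map_add, map_add, ← convPow_eq_coeff]
  have e1 : PowerSeries.coeff n ((j : PowerSeries ℝ) * PowerSeries.mk g ^ (j - 1) *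
      (PowerSeries.X ^ n * h)) = j * f 0 ^ (j - 1) * f n := by
    have : (j : PowerSeries ℝ) * PowerSeries.mk g ^ (j - 1) * (PowerSeries.X ^ n * h) =
        PowerSeries.X ^ n * ((j : PowerSeries ℝ) * PowerSeries.mk g ^ (j - 1) * h) := by ring
    rw [this, PowerSeries.coeff_X_pow_mul', if_pos le_rfl, Nat.sub_self,
      PowerSeries.coeff_zero_eq_constantCoeff_apply, map_mul, map_mul, map_pow, map_natCast, hcoeff]
    simp [hfg 0 hn]
  have e2 : PowerSeries.coeff n (k * (PowerSeries.X ^ n * h) ^ 2) = 0 := by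
    have : k * (PowerSeries.X ^ n * h) ^ 2 = PowerSeries.X ^ (2 * n) * (k * h ^ 2) := by ring
    rw [this, PowerSeries.coeff_X_pow_mul', if_neg (by omega)]
  rw [e1, e2]
  ring

lemma hasSum_convPow {f : ℕ → ℝ} (hf : ∀ k, 0 ≤ f k) {s A : ℝ} (hs : 0 ≤ s)
    (hA : HasSum (fun k => f k * s ^ k) A) (j : ℕ) :
    HasSum (fun l => convPow f j l * s ^ l) (A ^ j) := by
  have habs : ∀ k, ‖f k * s ^ k‖ = f k * s ^ k := fun k =>
    Real.norm_of_nonneg (mul_nonneg (hf k) (pow_nonneg hs k))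
  induction j with
  | zero =>
    rw [pow_zero]
    convert hasSum_ite_eq 0 (1 : ℝ) using 2 with l
    by_cases hl : l = 0 <;> simp [convPow_zero, hl]
  | succ j ih =>
    have habs' : ∀ k, ‖convPow f j k * s ^ k‖ = convPow f j k * s ^ k := fun k =>
      Real.norm_of_nonneg (mul_nonneg (convPow_nonneg hf j k) (pow_nonneg hs k))
    have h1 : Summable fun k => ‖f k * s ^ k‖ := by simpa only [habs] using hA.summable
    have h2 : Summable fun k => ‖convPow f j k * s ^ k‖ := by simpa only [habs'] using ih.summable
    have h3 := (summable_norm_sum_mul_antidiagonal_of_summable_norm h1 h2).of_norm.hasSum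
    rw [← tsum_mul_tsum_eq_tsum_sum_antidiagonal_of_summable_norm h1 h2, hA.tsum_eq,
      ih.tsum_eq, ← pow_succ'] at h3
    refine h3.congr_fun fun l => ?_
    rw [convPow_succ, Finset.sum_mul]
    refine Finset.sum_congr rfl fun p hp => ?_
    rw [← Finset.HasAntidiagonal.mem_antidiagonal.1 hp, pow_add]
    ring

end Convolution

/-! ### Comparison of coefficients in the functional equation -/

/-- A power series that vanishes on `(0, 1)` is zero. -/
lemma eq_zero_of_tsum_mul_pow {d : ℕ → ℝ} (hd : Summable fun l => |d l|)
    (h : ∀ s : ℝ, 0 < s → s < 1 → ∑' l, d l * s ^ l = 0) (l : ℕ) : d l = 0 := by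
  induction l using Nat.strong_induction_on with
  | _ n ih =>
    have hd' : Summable fun l => |d (l + n)| := (summable_nat_add_iff n).2 hd
    -- The coefficients below `n` vanish, so `s ^ n` can be divided out; letting `s → 0` then
    -- isolates `d n`.
    have hzero : ∀ s : ℝ, 0 < s → s < 1 → ∑' l, d (l + n) * s ^ l = 0 := by
      intro s hs0 hs1
      have hsum := summable_mul_pow hd ⟨hs0.le, hs1.le⟩
      have h1 := hsum.sum_add_tsum_nat_add n
      rw [h s hs0 hs1, Finset.sum_eq_zero fun i hi => by
        rw [ih i (Finset.mem_range.1 hi), zero_mul], zero_add] at h1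
      have h2 : ∑' l, d (l + n) * s ^ (l + n) = s ^ n * ∑' l, d (l + n) * s ^ l := by
        rw [← tsum_mul_left]
        exact tsum_congr fun l => by rw [pow_add]; ring
      rw [h2] at h1
      exact (mul_eq_zero.1 h1).resolve_left (pow_pos hs0 n).ne'
    have hcont := (continuousOn_tsum_mul_pow hd').continuousWithinAt
      (Set.left_mem_Icc.2 (zero_le_one' ℝ))
    have hlim := hcont.tendsto.mono_left (nhdsWithin_mono (0 : ℝ) Set.Ioo_subset_Icc_self)
    rw [tsum_mul_zero_pow, zero_add] at hlim
    have hne : (𝓝[Set.Ioo (0 : ℝ) 1] 0).NeBot := by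
      rw [nhdsWithin_Ioo_eq_nhdsGT zero_lt_one]; infer_instance
    refine tendsto_nhds_unique hlim (tendsto_const_nhds.congr' ?_)
    filter_upwards [self_mem_nhdsWithin] with s hs using (hzero s hs.1 hs.2).symm

/-- Comparison of the coefficients in `∑_{j ≠ m} bⱼ A(s)ʲ + s b_m A(s)ᵐ = 0`. -/
lemma coeff_equation {b : ℕ → ℝ} (hb : Summable fun j => |b j|) {m : ℕ} {a : ℕ → ℝ}
    (ha : ∀ k, 0 ≤ a k) (ha1 : HasSum a 1)
    (heq : ∀ s : ℝ, 0 < s → s < 1 →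
      ∑' j, (b j * if j = m then s else 1) * (∑' k, a k * s ^ k) ^ j = 0) (l : ℕ) :
    ∑' j, (if j = m then 0 else b j) * convPow a j l +
      (if l = 0 then 0 else b m * convPow a m (l - 1)) = 0 := by
  set β : ℕ → ℝ := fun j => if j = m then 0 else b j with hβ
  have hβs : Summable fun j => |β j| := by
    refine Summable.of_nonneg_of_le (fun _ => abs_nonneg _) (fun j => ?_) hb
    simp only [hβ]
    split_ifs
    · simp
    · exact le_rfl
  have hc1 : ∀ j, HasSum (convPow a j) 1 := by
    intro j
    have := hasSum_convPow ha zero_le_one (s := 1) (A := 1) (by simpa using ha1) j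
    simpa using this
  -- Each convolution power of `a` has total mass `1`, so the double series is dominated by `∑ |β
  -- j|`. This justifies interchanging the sums over `j` and `l` below.
  have hprod : Summable fun p : ℕ × ℕ => |β p.1| * convPow a p.1 p.2 := by
    rw [summable_prod_of_nonneg fun p => mul_nonneg (abs_nonneg _) (convPow_nonneg ha _ _)]
    have htsum : ∀ j, ∑' l, |β j| * convPow a j l = |β j| := fun j => by
      rw [tsum_mul_left, (hc1 j).tsum_eq, mul_one]
    exact ⟨fun j => (hc1 j).summable.mul_left |β j|, hβs.congr fun j => (htsum j).symm⟩
  have hnorm : ∀ p : ℕ × ℕ, |β p.1 * convPow a p.1 p.2| = |β p.1| * convPow a p.1 p.2 := fun p => by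
    rw [abs_mul, abs_of_nonneg (convPow_nonneg ha _ _)]
  have hshift : ∀ s A : ℝ, 0 ≤ s → HasSum (fun k => a k * s ^ k) A →
      HasSum (fun l => (if l = 0 then 0 else b m * convPow a m (l - 1)) * s ^ l)
        (b m * s * A ^ m) := by
    intro s A hs hA
    rw [← hasSum_nat_add_iff' 1]
    simp only [Finset.range_one, Finset.sum_singleton, if_true, zero_mul, sub_zero]
    refine ((hasSum_convPow ha hs hA m).mul_left (b m * s)).congr_fun fun l => ?_
    rw [if_neg (by omega), Nat.add_sub_cancel, pow_succ]
    ring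
  have hsum2 : Summable fun l => |if l = 0 then 0 else b m * convPow a m (l - 1)| := by
    have := (hshift 1 1 zero_le_one (by simpa using ha1)).summable
    simpa using this.abs
  have hsum1 : Summable fun l => |∑' j, β j * convPow a j l| := by
    have h1 := hprod.prod_symm.prod
    refine Summable.of_nonneg_of_le (fun _ => abs_nonneg _) (fun l => ?_) h1
    have hs : Summable fun j => |β j * convPow a j l| :=
      (hprod.prod_symm.prod_factor l).congr fun j => (hnorm (j, l)).symm
    refine (norm_tsum_le_tsum_norm (f := fun j => β j * convPow a j l) hs).trans_eq ?_
    exact tsum_congr fun j => hnorm (j, l)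
  refine eq_zero_of_tsum_mul_pow (d := fun l => ∑' j, β j * convPow a j l +
      (if l = 0 then 0 else b m * convPow a m (l - 1)))
    (Summable.of_nonneg_of_le (fun _ => abs_nonneg _) (fun l => abs_add_le _ _)
      (hsum1.add hsum2)) (fun s hs0 hs1 => ?_) l
  have hAsum : Summable fun k => a k * s ^ k := by
    refine summable_mul_pow ?_ ⟨hs0.le, hs1.le⟩
    simpa [abs_of_nonneg (ha _)] using ha1.summable
  set A := ∑' k, a k * s ^ k with hA
  have hA' : HasSum (fun k => a k * s ^ k) A := hAsum.hasSum
  have hA0 : 0 ≤ A := tsum_nonneg fun k => mul_nonneg (ha k) (pow_nonneg hs0.le k)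
  have hA1 : A ≤ 1 := by
    refine hasSum_le (fun k => ?_) hA' ha1
    exact mul_le_of_le_one_right (ha k) (pow_le_one₀ hs0.le hs1.le)
  simp only [add_mul]
  rw [Summable.tsum_add (summable_mul_pow hsum1 ⟨hs0.le, hs1.le⟩)
    (hshift s A hs0.le hA').summable, (hshift s A hs0.le hA').tsum_eq]
  have hcomm : ∑' l, (∑' j, β j * convPow a j l) * s ^ l = ∑' j, β j * A ^ j := by
    simp only [← tsum_mul_right]
    rw [Summable.tsum_comm]
    · refine tsum_congr fun j => ?_
      rw [← (hasSum_convPow ha hs0.le hA' j).tsum_eq, ← tsum_mul_left]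
      exact tsum_congr fun l => by ring
    · refine Summable.of_norm_bounded hprod fun p => ?_
      simp only [Function.uncurry, norm_mul, norm_pow, Real.norm_eq_abs,
        abs_of_nonneg (convPow_nonneg ha _ _), abs_of_nonneg hs0.le]
      exact mul_le_of_le_one_right (mul_nonneg (abs_nonneg _) (convPow_nonneg ha _ _))
        (pow_le_one₀ hs0.le hs1.le)
  have heqs := heq s hs0 hs1
  rw [← hA] at heqs
  rw [hcomm, ← heqs, ← (hasSum_ite_eq m (b m * s * A ^ m)).tsum_eq,
    ← Summable.tsum_add (summable_mul_pow hβs ⟨hA0, hA1⟩) (hasSum_ite_eq m _).summable]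
  refine tsum_congr fun j => ?_
  by_cases hj : j = m <;> simp [hβ, hj]

/-! ### Tangent inequalities and termwise differentiation -/

section Tangent

lemma pow_tangent_le {x y : ℝ} (hx : 0 ≤ x) (hy : 0 ≤ y) (j : ℕ) :
    y ^ j + j * y ^ (j - 1) * (x - y) ≤ x ^ j := by
  induction j with
  | zero => simp
  | succ j ih =>
    rw [Nat.add_sub_cancel]
    have h1 := mul_le_mul_of_nonneg_left ih hx
    have h2 : 0 ≤ (j : ℝ) * y ^ (j - 1) * (x - y) ^ 2 :=
      mul_nonneg (mul_nonneg (Nat.cast_nonneg _) (pow_nonneg hy _)) (sq_nonneg _)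
    have h3 : (j : ℝ) * y ^ j = j * y ^ (j - 1) * y := by
      cases j with
      | zero => simp
      | succ j => rw [Nat.add_sub_cancel, pow_succ]; ring
    push_cast
    rw [pow_succ', pow_succ']
    nlinarith

/-- The tangent to `x ^ j` at `y`, evaluated at `1`, gives a bound independent of `j`. Hence
absolute summability of the coefficients alone dominates the differentiated series on `[0, r]` for
`r < 1`. -/
lemma mul_pow_pred_le {y : ℝ} (hy0 : 0 ≤ y) (hy1 : y < 1) (j : ℕ) :
    j * y ^ (j - 1) ≤ (1 - y)⁻¹ := by
  have h := pow_tangent_le zero_le_one hy0 j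
  rw [one_pow] at h
  rw [← one_div, le_div_iff₀ (by linarith)]
  have := pow_nonneg hy0 j
  linarith

variable {β : ℕ → ℝ}

lemma summable_mul_pow_pred (hβ : Summable fun j => |β j|) {y : ℝ} (hy0 : 0 ≤ y) (hy1 : y < 1) :
    Summable fun j : ℕ => β j * (j * y ^ (j - 1)) := by
  refine Summable.of_norm_bounded (hβ.mul_right (1 - y)⁻¹) fun j => ?_
  rw [norm_mul, Real.norm_eq_abs,
    Real.norm_of_nonneg (mul_nonneg (Nat.cast_nonneg _) (pow_nonneg hy0 _))]
  exact mul_le_mul_of_nonneg_left (mul_pow_pred_le hy0 hy1 j) (abs_nonneg _)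

lemma deriv_tsum_mul_pow (hβ : Summable fun j => |β j|) {y : ℝ} (hy0 : 0 < y) (hy1 : y < 1) :
    deriv (fun u : ℝ => ∑' j, β j * u ^ j) y = ∑' j : ℕ, β j * (j * y ^ (j - 1)) := by
  obtain ⟨r, hyr, hr1⟩ := exists_between hy1
  refine (hasDerivAt_tsum_of_isPreconnected (t := Set.Ioo 0 r) (y₀ := y)
    (hβ.mul_right (1 - r)⁻¹) isOpen_Ioo isPreconnected_Ioo
    (fun j u _ => (hasDerivAt_pow j u).const_mul (β j)) (fun j u hu => ?_) ⟨hy0, hyr⟩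
    (summable_mul_pow hβ ⟨hy0.le, hy1.le⟩) ⟨hy0, hyr⟩).deriv
  rw [norm_mul, Real.norm_eq_abs,
    Real.norm_of_nonneg (mul_nonneg (Nat.cast_nonneg _) (pow_nonneg hu.1.le _))]
  refine mul_le_mul_of_nonneg_left ?_ (abs_nonneg _)
  refine (mul_pow_pred_le hu.1.le (hu.2.trans hr1) j).trans ?_
  exact inv_anti₀ (by linarith) (by linarith [hu.2])

/-- A power series with nonnegative coefficients except the linear one lies above its tangents. -/
lemma tsum_tangent_le (hβ : Summable fun j => |β j|) (hnn : ∀ j, j ≠ 1 → 0 ≤ β j) {x y : ℝ}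
    (hx : x ∈ Set.Icc 0 1) (hy0 : 0 ≤ y) (hy1 : y < 1) :
    ∑' j, β j * y ^ j + (x - y) * ∑' j : ℕ, β j * (j * y ^ (j - 1)) ≤ ∑' j, β j * x ^ j := by
  have h := (summable_mul_pow hβ ⟨hy0, hy1.le⟩).hasSum.add
    ((summable_mul_pow_pred hβ hy0 hy1).hasSum.mul_left (x - y))
  refine hasSum_le (fun j => ?_) h (summable_mul_pow hβ hx).hasSum
  by_cases hj : j = 1
  · subst hj; simp; ring_nf; exact le_rfl
  · have := mul_le_mul_of_nonneg_left (pow_tangent_le hx.1 hy0 j) (hnn j hj)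
    linarith

end Tangent

/-! ### Identification of the distribution with the coefficients `ρ_k` -/

section Coefficients

variable {b w a : ℕ → ℝ}

lemma eq_deathCoeff (hbw : IsData b w) (hb0 : 0 < b 0) (ha : ∀ k, 0 ≤ a k) (ha1 : a 0 ≤ 1)
    (heq : ∀ l, ∑' j, (if j = 0 then 0 else b j) * convPow a j l +
      (if l = 0 then 0 else b 0 * convPow a 0 (l - 1)) = 0) (k : ℕ) :
    a k = deathCoeff b k := by
  have hb1 := hbw.neg
  have ha0 : a 0 = 0 := by
    have h := heq 0
    simp only [convPow_zero_right, if_true, add_zero] at h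
    -- Replacing `a 0 ^ j` by the larger `a 0` for `j ≥ 2` in the equation for `l = 0` leaves `0 ≤
    -- -b 0 * a 0`, which forces `a 0 = 0`.
    have hβ : HasSum (fun j => (if j = 0 then 0 else b j) * a 0) (-b 0 * a 0) := by
      have := hbw.hasSum_zero.sub (hasSum_ite_eq 0 (b 0))
      rw [zero_sub] at this
      refine (this.mul_right (a 0)).congr_fun fun j => ?_
      by_cases hj : j = 0 <;> simp [hj]
    have hs : Summable fun j => (if j = 0 then 0 else b j) * a 0 ^ j := by
      refine summable_mul_pow ?_ ⟨ha 0, ha1⟩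
      refine Summable.of_nonneg_of_le (fun _ => abs_nonneg _) (fun j => ?_) hbw.summable_abs
      split_ifs <;> simp
    have hle := hasSum_le (fun j => ?_) hs.hasSum hβ
    · rw [h] at hle
      have := ha 0
      nlinarith
    · by_cases h0 : j = 0
      · simp [h0]
      by_cases h1 : j = 1
      · simp [h1]
      · rw [if_neg h0]
        refine mul_le_mul_of_nonneg_left ?_ (hbw.nonneg j h1)
        exact pow_le_of_le_one (ha 0) ha1 h0
  -- As `a 0 = 0`, the `j`-th convolution power vanishes below index `j`, so the series over `j`
  -- stops at `l`.
  have hfin : ∀ l, 0 < l → ∑ j ∈ Finset.Icc 2 l, b j * convPow a j l + b 1 * a l +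
      b 0 * (if l = 1 then 1 else 0) = 0 := by
    intro l hl
    have h := heq l
    rw [tsum_eq_sum (s := Finset.Icc 1 l) fun j hj => ?_, if_neg hl.ne', convPow_zero] at h
    · have hIcc : Finset.Icc 1 l = insert 1 (Finset.Icc 2 l) := by
        ext j
        simp only [Finset.mem_Icc, Finset.mem_insert]
        omega
      refine Eq.trans ?_ h
      rw [hIcc, Finset.sum_insert (by simp), convPow_one_left, if_neg one_ne_zero,
        add_comm (∑ j ∈ _, _)]
      congr 1
      · congr 1
        refine Finset.sum_congr rfl fun j hj => ?_
        rw [if_neg (by simp at hj; omega)]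
      · simp only [show l - 1 = 0 ↔ l = 1 by omega]
    · rcases Nat.eq_zero_or_pos j with h0 | h0
      · simp [h0]
      · rw [convPow_of_lt ha0 (by simp at hj; omega), mul_zero]
  induction k using Nat.strong_induction_on with
  | _ k ih =>
    match k with
    | 0 => rw [ha0, deathCoeff]
    | 1 =>
      have h := hfin 1 one_pos
      rw [deathCoeff, ← neg_div, eq_div_iff hb1.ne]
      simp at h
      linarith
    | k + 2 =>
      have h := hfin (k + 2) (by omega)
      have htr : (fun l => if _h : l ≤ k + 1 then deathCoeff b l else 0) =
          fun l => if l ≤ k + 1 then a l else 0 := by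
        ext l
        split_ifs with hl
        · exact (ih l (by omega)).symm
        · rfl
      rw [deathCoeff, htr, eq_div_iff hb1.ne]
      have hcongr : ∑ j ∈ Finset.Icc 2 (k + 2), b j * convPow a j (k + 2) =
          ∑ j ∈ Finset.Icc 2 (k + 2),
            b j * convPow (fun l => if l ≤ k + 1 then a l else 0) j (k + 2) := by
        refine Finset.sum_congr rfl fun j hj => ?_
        rw [Finset.mem_Icc] at hj
        -- The top coefficient `a (k + 2)` enters with the factor `j * a 0 ^ (j - 1) = 0` for `j ≥
        -- 2`, so truncation changes nothing.
        rw [convPow_eq_add (f := a) (g := fun l => if l ≤ k + 1 then a l else 0) (by omega)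
          (fun l hl => if_pos (by omega)) (if_neg (by omega)), ha0, zero_pow (by omega)]
        ring
      rw [hcongr, if_neg (by omega)] at h
      linarith

lemma eq_upCoeff (hbw : IsData b w) {m : ℕ} (hbm : 0 < b m) (hm0 : m ≠ 0)
    (hb0 : 0 < b 0) (ha : ∀ k, 0 ≤ a k) (ha1 : a 0 ≤ 1)
    (heq : ∀ l, ∑' j, (if j = m then 0 else b j) * convPow a j l +
      (if l = 0 then 0 else b m * convPow a m (l - 1)) = 0)
    (hc : ∀ j l, convPow a j l ≤ 1) (k : ℕ) :
    a k = upCoeff b m k := by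
  set β : ℕ → ℝ := fun j => if j = m then 0 else b j with hβ
  have hβs : Summable fun j => |β j| := by
    refine Summable.of_nonneg_of_le (fun _ => abs_nonneg _) (fun j => ?_) hbw.summable_abs
    simp only [hβ]
    split_ifs <;> simp
  have hβnn : ∀ j, j ≠ 1 → 0 ≤ β j := fun j hj => by
    simp only [hβ]
    split_ifs
    · exact le_rfl
    · exact hbw.nonneg j hj
  have hF : genFunOmit b m = fun u => ∑' j, β j * u ^ j := by
    ext u
    unfold genFunOmit
    refine tsum_congr fun j => ?_
    by_cases hj : j = m <;> simp [hβ, hj]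
  have hFone : ∑' j, β j * (1 : ℝ) ^ j = -b m := by
    have := hbw.hasSum_zero.sub (hasSum_ite_eq m (b m))
    rw [zero_sub] at this
    rw [← this.tsum_eq]
    refine tsum_congr fun j => ?_
    by_cases hj : j = m <;> simp [hβ, hj]
  have hFzero : ∑' j, β j * (0 : ℝ) ^ j = b 0 := by
    rw [tsum_mul_zero_pow]
    exact if_neg hm0.symm
  have hroot : ∑' j, β j * a 0 ^ j = 0 := by
    have h := heq 0
    rw [if_pos rfl, add_zero] at h
    simpa only [convPow_zero_right] using h
  have hlt1 : a 0 < 1 := lt_of_le_of_ne ha1 fun h => by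
    rw [h, hFone] at hroot; linarith
  have hpos : 0 < a 0 := lt_of_le_of_ne (ha 0) fun h => by
    rw [← h, hFzero] at hroot; linarith
  have hderiv : deriv (genFunOmit b m) (a 0) = ∑' j : ℕ, β j * (j * a 0 ^ (j - 1)) := by
    rw [hF]; exact deriv_tsum_mul_pow hβs hpos hlt1
  set D := ∑' j : ℕ, β j * (j * a 0 ^ (j - 1)) with hD
  -- The tangent to `B_m` at its root `a 0`, evaluated at `1`, lies below `B_m(1) = -b m < 0`.
  have hDneg : D < 0 := by
    have h := tsum_tangent_le hβs hβnn (x := 1) (by simp) hpos.le hlt1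
    rw [hroot, hFone, ← hD] at h
    by_contra hcon
    have := mul_nonneg (sub_nonneg.2 hlt1.le) (not_lt.1 hcon)
    linarith
  have hzero : a 0 = upCoeff b m 0 := by
    rw [upCoeff, minRoot]
    have hmem : a 0 ∈ {u : ℝ | 0 ≤ u ∧ genFunOmit b m u = 0} := ⟨hpos.le, by rw [hF]; exact hroot⟩
    -- At a root `u < a 0` the tangent at `a 0` would have the positive value `(u - a 0) * D`, yet
    -- it lies below `B_m(u) = 0`. So `a 0` is the minimal root.
    refine le_antisymm (le_csInf ⟨_, hmem⟩ fun u hu => ?_) (csInf_le ⟨0, fun x hx => hx.1⟩ hmem)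
    by_contra hcon
    have hcon := not_le.1 hcon
    have h := tsum_tangent_le hβs hβnn (x := u) ⟨hu.1, (hcon.trans hlt1).le⟩ hpos.le hlt1
    have h2 := hu.2
    rw [hF] at h2
    simp only at h2
    rw [hroot, h2, ← hD] at h
    have := mul_pos_of_neg_of_neg (sub_neg.2 hcon) hDneg
    linarith
  -- Isolating the linear occurrences of `a n` in the `n`-th equation collects the factor `∑ β j * j
  -- * a 0 ^ (j - 1) = D`. What remains involves only the truncation `g` and earlier coefficients.
  have hsplit : ∀ (n : ℕ) (g : ℕ → ℝ), 0 < n → (∀ l < n, g l = a l) → g n = 0 →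
      a n * D + ∑' j, β j * convPow g j n + b m * convPow a m (n - 1) = 0 := by
    intro n g hn hg hgn
    have h := heq n
    rw [if_neg hn.ne'] at h
    have hs : Summable fun j => β j * convPow a j n := by
      refine Summable.of_norm_bounded hβs fun j => ?_
      rw [norm_mul, Real.norm_eq_abs, Real.norm_of_nonneg (convPow_nonneg ha _ _)]
      exact mul_le_of_le_one_right (abs_nonneg _) (hc j n)
    have hs1 := (summable_mul_pow_pred hβs hpos.le hlt1).mul_left (a n)
    have hs2 : HasSum (fun j => β j * convPow g j n) (∑' j, β j * convPow a j n - a n * D) := by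
      have := hs.hasSum.sub hs1.hasSum
      rw [tsum_mul_left] at this
      refine this.congr_fun fun j => ?_
      rw [convPow_eq_add hn hg hgn j]
      ring
    rw [hs2.tsum_eq]
    linarith
  induction k using Nat.strong_induction_on with
  | _ k ih =>
    match k with
    | 0 => exact hzero
    | 1 =>
      have h := hsplit 1 (fun l => if l = 0 then a 0 else 0) one_pos
        (fun l hl => by rw [if_pos (by omega), show l = 0 by omega]) (if_neg one_ne_zero)
      have hg : ∀ j, convPow (fun l => if l = 0 then a 0 else 0) j 1 = 0 := by
        intro j
        have : PowerSeries.mk (fun l => if l = 0 then a 0 else 0) = PowerSeries.C (a 0) := by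
          ext l
          rw [PowerSeries.coeff_mk, PowerSeries.coeff_C]
        rw [convPow_eq_coeff, this, ← map_pow, PowerSeries.coeff_C, if_neg one_ne_zero]
      simp only [hg, mul_zero, tsum_zero, add_zero, Nat.sub_self, convPow_zero_right] at h
      rw [upCoeff, ← hzero, hderiv, ← neg_div, eq_div_iff hDneg.ne]
      linarith
    | k + 2 =>
      have htr : (fun l => if _h : l ≤ k + 1 then upCoeff b m l else 0) =
          fun l => if l ≤ k + 1 then a l else 0 := by
        ext l
        split_ifs with hl
        · exact (ih l (by omega)).symm
        · rfl
      have h := hsplit (k + 2) (fun l => if l ≤ k + 1 then a l else 0) (by omega)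
        (fun l hl => if_pos (by omega)) (if_neg (by omega))
      have hg : convPow a m (k + 2 - 1) =
          convPow (fun l => if l ≤ k + 1 then a l else 0) m (k + 1) := by
        unfold convPow
        refine Finset.sum_congr rfl fun x hx => Finset.prod_congr rfl fun i _ => ?_
        rw [Finset.Nat.mem_antidiagonalTuple] at hx
        have := Finset.single_le_sum (f := x) (fun _ _ => Nat.zero_le _) (Finset.mem_univ i)
        exact (if_pos (by omega)).symm
      have hsum : ∑' j, β j * convPow (fun l => if l ≤ k + 1 then a l else 0) j (k + 2) =
          ∑' i : ℕ, if i = 1 ∨ i = m then 0 else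
            b i * convPow (fun l => if l ≤ k + 1 then a l else 0) i (k + 2) := by
        refine tsum_congr fun j => ?_
        by_cases hj : j = m
        · simp [hβ, hj]
        -- The recursion omits `i = 1`; its term is the truncated sequence at `k + 2`, which is `0`.
        by_cases hj1 : j = 1
        · simp [hj1, convPow_one_left]
        · simp [hβ, hj, hj1]
      rw [hg, hsum] at h
      rw [upCoeff, htr, ← hzero, hderiv, eq_div_iff hDneg.ne]
      linarith

lemma eq_coeff (hbw : IsData b w) {m : ℕ} (hbm : 0 < b m) (hb0 : 0 < b 0)
    (ha : ∀ k, 0 ≤ a k) (ha1 : HasSum a 1)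
    (heq : ∀ s : ℝ, 0 < s → s < 1 →
      ∑' j, (b j * if j = m then s else 1) * (∑' k, a k * s ^ k) ^ j = 0) (k : ℕ) :
    a k = coeff b m k := by
  have hd := coeff_equation hbw.summable_abs ha ha1 heq
  have ha0 : a 0 ≤ 1 := le_hasSum ha1 0 fun k _ => ha k
  have hc : ∀ j l, convPow a j l ≤ 1 := by
    intro j l
    have := hasSum_convPow ha zero_le_one (s := 1) (A := 1) (by simpa using ha1) j
    have := le_hasSum this l fun i _ => mul_nonneg (convPow_nonneg ha j i) (by simp)
    simpa using this
  unfold coeff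
  split_ifs with h0
  · subst h0
    exact eq_deathCoeff hbw hb0 ha ha0 hd k
  · exact eq_upCoeff hbw hbm h0 hb0 ha ha0 hd hc k

end Coefficients

/-! ### Moments of integer-valued random variables -/

section Moments

variable {Ω : Type*} [MeasurableSpace Ω] {μ : Measure Ω} {Y : Ω → ℕ}

lemma lintegral_comp_nat (hY : Measurable Y) (F : ℕ → ℝ≥0∞) :
    ∫⁻ ω, F (Y ω) ∂μ = ∑' k, F k * μ (Y ⁻¹' {k}) := by
  rw [← lintegral_map (measurable_of_countable F) hY, lintegral_countable']
  exact tsum_congr fun k => by rw [Measure.map_apply hY (measurableSet_singleton k)]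

lemma hasSum_measureReal_preimage [IsProbabilityMeasure μ] (hY : Measurable Y) :
    HasSum (fun k => μ.real (Y ⁻¹' {k})) 1 := by
  have h := lintegral_comp_nat (μ := μ) hY fun _ => 1
  simp only [lintegral_one, measure_univ, one_mul] at h
  have h' := ENNReal.hasSum_toReal (f := fun k => μ (Y ⁻¹' {k})) (by rw [← h]; simp)
  rwa [← ENNReal.tsum_toReal_eq fun k => measure_ne_top _ _, ← h, ENNReal.toReal_one] at h'

lemma tsum_measureReal_mul_pow [IsProbabilityMeasure μ] (hY : Measurable Y) {s v : ℝ} (hs : 0 ≤ s) (hv : 0 ≤ v)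
    (h : ∫⁻ ω, ENNReal.ofReal s ^ Y ω ∂μ = ENNReal.ofReal v) :
    ∑' k, μ.real (Y ⁻¹' {k}) * s ^ k = v := by
  rw [lintegral_comp_nat hY fun k => ENNReal.ofReal s ^ k] at h
  have h' := congrArg ENNReal.toReal h
  rw [ENNReal.toReal_ofReal hv, ENNReal.tsum_toReal_eq fun k =>
    ENNReal.mul_ne_top (by simp) (measure_ne_top _ _)] at h'
  rw [← h']
  refine tsum_congr fun k => ?_
  rw [ENNReal.toReal_mul, ENNReal.toReal_pow, ENNReal.toReal_ofReal hs, mul_comm]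
  rfl

/-- A finite mean is required because the variance is centred at the Bochner integral, which would
be `0` by convention if the mean were infinite. -/
lemma evariance_natCast [IsProbabilityMeasure μ] (hY : Measurable Y) (hfin : ∫⁻ ω, (Y ω : ℝ≥0∞) ∂μ < ⊤) :
    evariance (fun ω => (Y ω : ℝ)) μ =
      ∫⁻ ω, (Y ω : ℝ≥0∞) ^ 2 ∂μ - (∫⁻ ω, (Y ω : ℝ≥0∞) ∂μ) ^ 2 := by
  have hm : Measurable fun ω => (Y ω : ℝ) := (measurable_of_countable _).comp hY
  rw [evariance_def' hm.aestronglyMeasurable]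
  have hint : ∫ ω, (Y ω : ℝ) ∂μ = (∫⁻ ω, (Y ω : ℝ≥0∞) ∂μ).toReal := by
    rw [integral_eq_lintegral_of_nonneg_ae (Eventually.of_forall fun _ => Nat.cast_nonneg _)
      hm.aestronglyMeasurable]
    simp
  rw [hint, ENNReal.ofReal_pow ENNReal.toReal_nonneg, ENNReal.ofReal_toReal hfin.ne]
  congr 1
  refine lintegral_congr fun ω => ?_
  rw [Real.enorm_of_nonneg (Nat.cast_nonneg _), ENNReal.ofReal_natCast]

end Moments

/-! ### The crossing number as a random variable -/

/-- A version of the crossing number until extinction that is everywhere finite and measurable,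
together with the generating function equation of its distribution. -/
lemma exists_crossing_version {Ω : Type*} [MeasurableSpace Ω] {μ : Measure Ω}
    [IsProbabilityMeasure μ] {b w : ℕ → ℝ} (hbw : IsData b w) {X : ℝ≥0 → Ω → ℕ}
    (hX : IsProcess μ b w X) (hX0 : ∀ᵐ ω ∂μ, X 0 ω = 1) {m : ℕ} (hm : m ≠ 1) (hbm : 0 < b m)
    (hroot : minRoot (genFun b) = 1) :
    ∃ Y : Ω → ℕ, Measurable Y ∧
      (∀ᵐ ω ∂μ, extinctionTime (fun t => X t ω) < ⊤ ∧
        crossingsUntilExtinction m (fun t => X t ω) = Y ω) ∧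
      ∀ s : ℝ, 0 < s → s < 1 → ∑' j, (b j * if j = m then s else 1) *
        (∑' k, μ.real (Y ⁻¹' {k}) * s ^ k) ^ j = 0 := by
  obtain ⟨Z, hZm, hZ, hlaw⟩ := exists_jumpChain_law hbw hX hX0
  have hhit : ∀ᵐ ω ∂μ, ∃ n, Z n ω = 0 := by
    refine ae_exists_eq_zero hbw hZm hlaw fun v hv0 hv1 =>
      ⟨_, hasSum_ne_one hbw.summable_abs ⟨hv0.le, hv1.le⟩, ?_⟩
    have := genFun_pos_of_minRoot hbw hroot hv0.le hv1
    unfold genFun at this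
    linarith
  -- Almost surely the step counts increase to a finite limit, which is recovered exactly. On the
  -- exceptional null set `toReal` and the floor still give some natural number, so `Y` is
  -- measurable everywhere.
  set Y : Ω → ℕ := fun ω => ⌊(⨆ n, (stepCount m (fun k => Z k ω) n : ℝ≥0∞)).toReal⌋₊ with hYdef
  have hYm : Measurable Y := by
    refine Nat.measurable_floor.comp (ENNReal.measurable_toReal.comp (Measurable.iSup fun n => ?_))
    exact (measurable_of_countable fun k : ℕ => (k : ℝ≥0∞)).comp (measurable_stepCount hZm m n)
  have hmain : ∀ᵐ ω ∂μ, (∀ᶠ n in atTop, Z n ω = 0 ∧ stepCount m (fun k => Z k ω) n = Y ω) ∧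
      extinctionTime (fun t => X t ω) < ⊤ ∧
        crossingsUntilExtinction m (fun t => X t ω) = Y ω := by
    filter_upwards [hZ, hhit, hX.2] with ω h1 h2 h3
    obtain ⟨N, hN⟩ := h2
    obtain ⟨hc1, hc2⟩ := stepCount_eventually hm (z := fun k => Z k ω)
      (fun n hn => by
        rw [h1] at hn ⊢
        exact jumpChain_eq_zero_succ n _ hn) hN
    have hmono : Monotone (stepCount m fun k => Z k ω) := fun n n' hn =>
      Finset.card_le_card (Finset.filter_subset_filter _ (Finset.range_mono hn))
    have hsup : (⨆ n, (stepCount m (fun k => Z k ω) n : ℝ≥0∞)) =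
        stepCount m (fun k => Z k ω) N := by
      refine le_antisymm (iSup_le fun n => ?_) (le_iSup (fun n => (stepCount m _ n : ℝ≥0∞)) N)
      rcases le_total n N with hn | hn
      · exact_mod_cast hmono hn
      · rw [(hc1 n hn).2]
    have hYω : Y ω = stepCount m (fun k => Z k ω) N := by
      rw [hYdef]
      simp only [hsup, ENNReal.toReal_natCast, Nat.floor_natCast]
    refine ⟨?_, ?_⟩
    · filter_upwards [eventually_ge_atTop N] with n hn
      exact ⟨(hc1 n hn).1, by rw [(hc1 n hn).2, hYω]⟩
    · have hcross := crossingsUntilExtinction_eq hm N (x := fun t => X t ω) h3.1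
        (by rw [← h1]; exact hN)
      refine ⟨hcross.1, ?_⟩
      rw [hcross.2, hYω, ← hc2]
      simp only [h1]
  refine ⟨Y, hYm, hmain.mono fun ω h => h.2, fun s hs0 hs1 => ?_⟩
  -- Any root in `[0, 1]` will do: the martingale identity shows that it equals the generating
  -- function at `s`.
  obtain ⟨v, hv, hveq⟩ := exists_root_marked hbw hbm hs0.le hs1.le
  have hsum := hasSum_ne_one (summable_abs_mul_marked hbw m hs0.le hs1.le) hv
  rw [hveq, if_neg hm.symm, mul_one, zero_sub, ← neg_mul] at hsum
  have hgen := lintegral_pow_stepCount hbw hZm hlaw hm (hmain.mono fun ω h => h.1) hs0.le hs1.le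
    hv.1 hv.2 hsum
  rw [tsum_measureReal_mul_pow hYm hs0.le hv.1 hgen]
  exact hveq

end WMB

theorem theorem3p2 {Ω : Type*} [MeasurableSpace Ω] (μ : Measure Ω) [IsProbabilityMeasure μ]
    (b w : ℕ → ℝ) (hbw : WMB.IsData b w)
    (X : ℝ≥0 → Ω → ℕ) (hX : WMB.IsProcess μ b w X) (hX0 : ∀ᵐ ω ∂μ, X 0 ω = 1)
    (m : ℕ) (hm : m ≠ 1) (hbm : 0 < b m) :
    (WMB.minRoot (WMB.genFun b) = 1 ↔ WMB.DerivOneNonpos b) ∧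
    (WMB.minRoot (WMB.genFun b) = 1 →
      (∀ k, 0 ≤ WMB.coeff b m k) ∧
      (∀ᵐ ω ∂μ, WMB.extinctionTime (fun t => X t ω) < ⊤ ∧
        WMB.crossingsUntilExtinction m (fun t => X t ω) < ⊤) ∧
      AEMeasurable (fun ω => (WMB.crossingsUntilExtinction m (fun t => X t ω) : ℝ≥0∞)) μ ∧
      ∫⁻ ω, (WMB.crossingsUntilExtinction m (fun t => X t ω) : ℝ≥0∞) ∂μ =
        ∑' k : ℕ, (k : ℝ≥0∞) * ENNReal.ofReal (WMB.coeff b m k) ∧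
      (∑' k : ℕ, (k : ℝ≥0∞) * ENNReal.ofReal (WMB.coeff b m k) < ⊤ →
        evariance
            (fun ω => (WMB.crossingsUntilExtinction m (fun t => X t ω) : ℝ≥0∞).toReal) μ =
          ∑' k : ℕ, (k : ℝ≥0∞) ^ 2 * ENNReal.ofReal (WMB.coeff b m k) -
            (∑' k : ℕ, (k : ℝ≥0∞) * ENNReal.ofReal (WMB.coeff b m k)) ^ 2)) := by
  refine ⟨WMB.minRoot_genFun_eq_one_iff hbw, fun hroot => ?_⟩
  obtain ⟨Y, hYm, hY, heq⟩ := WMB.exists_crossing_version hbw hX hX0 hm hbm hroot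
  -- `B` is positive on `[0, 1)`, in particular `B(0) = b 0 > 0`.
  have hb0 : 0 < b 0 := by
    have := WMB.genFun_pos_of_minRoot hbw hroot le_rfl zero_lt_one
    rwa [WMB.genFun, WMB.tsum_mul_zero_pow] at this
  have hcoeff : ∀ k, μ.real (Y ⁻¹' {k}) = WMB.coeff b m k :=
    WMB.eq_coeff hbw hbm hb0 (fun _ => measureReal_nonneg)
      (WMB.hasSum_measureReal_preimage hYm) heq
  have hofReal : ∀ k, ENNReal.ofReal (WMB.coeff b m k) = μ (Y ⁻¹' {k}) := fun k => by
    rw [← hcoeff, ofReal_measureReal]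
  have hcast : (fun ω => (WMB.crossingsUntilExtinction m (fun t => X t ω) : ℝ≥0∞)) =ᵐ[μ]
      fun ω => (Y ω : ℝ≥0∞) := by
    filter_upwards [hY] with ω hω
    rw [hω.2, ENat.toENNReal_coe]
  have hmean : ∫⁻ ω, (Y ω : ℝ≥0∞) ∂μ =
      ∑' k : ℕ, (k : ℝ≥0∞) * ENNReal.ofReal (WMB.coeff b m k) := by
    simp only [hofReal]
    exact WMB.lintegral_comp_nat hYm fun k => (k : ℝ≥0∞)
  have hsq : ∫⁻ ω, (Y ω : ℝ≥0∞) ^ 2 ∂μ =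
      ∑' k : ℕ, (k : ℝ≥0∞) ^ 2 * ENNReal.ofReal (WMB.coeff b m k) := by
    simp only [hofReal]
    exact WMB.lintegral_comp_nat hYm fun k => (k : ℝ≥0∞) ^ 2
  refine ⟨fun k => hcoeff k ▸ measureReal_nonneg, ?_, ?_, ?_, fun hfin => ?_⟩
  · filter_upwards [hY] with ω hω
    exact ⟨hω.1, by rw [hω.2]; exact ENat.natCast_lt_top _⟩
  · exact ⟨_, (measurable_of_countable fun k : ℕ => (k : ℝ≥0∞)).comp hYm, hcast⟩
  · rw [lintegral_congr_ae hcast, hmean]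
  · have hae : (fun ω => (WMB.crossingsUntilExtinction m (fun t => X t ω) : ℝ≥0∞).toReal) =ᵐ[μ]
        fun ω => (Y ω : ℝ) := by
      filter_upwards [hcast] with ω hω
      rw [hω, ENNReal.toReal_natCast]
    rw [evariance_congr hae, WMB.evariance_natCast hYm (by rwa [hmean]), hmean, hsq]
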